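/- Let $p\ge 2$ be an integer, let $\mathrm{BS}(1,p)=\langle a,t\mid tat^{-1}=a^p\rangle$ and $X=\{a,a^{-1},t,t^{-1}\}$. For integers $n,\alpha$ let $(a^{n})^{t^{\alpha}}$ denote the word $t^{-\alpha}a^{n}t^{\alpha}$ over $X$ (no free reduction is performed), and let $L_p\subseteq X^*$ be the set of all words of one of the three forms \begin{itemize} \item $t^i$, \item $(a^{\eta_0})^{t^{\alpha_0}}(a^{\eta_1})^{t^{\alpha_1}}\cdots(a^{\eta_k})^{t^{\alpha_k}}\,t^i$, \item $(a^{-\eta_0})^{t^{\alpha_0}}(a^{-\eta_1})^{t^{\alpha_1}}\cdots(a^{-\eta_k})^{t^{\alpha_k}}\,t^i$, \end{itemize} where $i\in\mathbb Z$, $k\ge 0$, the $\eta_j$ and $\alpha_j$ are integers, $0<\eta_j<p$ and $\alpha_0>\alpha_1>\dots>\alpha_k$. Then: \begin{enumerate} \item $L_p$ is a normal form for $\mathrm{BS}(1,p)$, that is, the map sending a word to the group element it represents restricts to a bijection $L_p\to \mathrm{BS}(1,p)$; and it is computable in logspace: there is a function $f:X^*\to X^*$ such that for every $w\in X^*$ the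 word $f(w)$ is the element of $L_p$ representing the same group element as $w$, and $f$ is computed by a deterministic logspace transducer, i.e. a machine with a finite state control, a read-only input tape, a write-only output tape, and a read-write work tape of which at most $c(\lfloor\log_2 n\rfloor+1)$ squares (just $c$ squares if $n=0$) are used on inputs of length $n$, where $c$ is a constant that does not depend on the input. \item Every element of $\mathrm{BS}(1,p)$ can be written in exactly one way in exactly one of the three forms, that is, the form and the parameters $i,k,\eta_j,\alpha_j$ are uniquely determined. \item There is an injective homomorphism $\rho$ from $\mathrm{BS}(1,p)$ to the $2\times2$ rational matrices under multiplication with $\rho(t)=\begin{pmatrix}p&0\\0&1\end{pmatrix}$ and $\rho(a)=\begin{pmatrix}1&1\\0&1\end{pmatrix}$, whose image is the set of all $\begin{pmatrix}p^i&m\\0&1\end{pmatrix}$ with $i\in\mathbb Z$, $m\in\mathbb Z[\frac1p]$. The element represented by a word of $L_p$ is sent to $\begin{pmatrix}p^i&m\\0&1\end{pmatrix}$, where $m=0$, $m=\sum_{j=0}^k\eta_jp^{-\alpha_j}$ or $m=-\sum_{j=0}^k\eta_jp^{-\alpha_j}$ according to which of the three forms the word has; so the word records the (signed) $p$-ary expansion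 of $m$. \end{enumerate} -/

import Mathlib

/-! ### Deterministic logspace transducers -/

namespace Logspace

/-- What the input head can see: one of the two end markers, or a letter of the input word. -/
inductive InSym (X : Type*) where
  | leftEnd : InSym X
  | letter (x : X) : InSym X
  | rightEnd : InSym X

/-- Movements of a tape head. -/
inductive Move where
  | left : Move
  | stay : Move
  | right : Move

/-- A deterministic transducer with a finite state control, a read-only two-way input tape, one
read-write work tape and a write-only output tape. According to the current state, the symbol under
the input head and the symbol under the work head, it either halts (`none`) or changes its state,
overwrites the scanned work square, moves the input head and the work head, and appends a word to
the output. As states, input symbols and work symbols are finite in number, the length of the word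
that is appended in one step is bounded by a constant. -/
structure Transducer (X Y : Type*) where
  /-- the states of the finite control -/
  Q : Type
  /-- the work tape alphabet -/
  Γ : Type
  finite_Q : Finite Q
  finite_Γ : Finite Γ
  start : Q
  blank : Γ
  /-- new state, symbol written, move of the input head, move of the work head, output -/
  next : Q → InSym X → Γ → Option (Q × Γ × Move × Move × List Y)

/-- The symbol at position `i` of the input tape: the left end marker stands at `0`, the letters of
`w` at `1, …, |w|`, the right end marker at `|w| + 1`. -/
def readInput {X : Type*} (w : List X) : ℕ → InSym X
  | 0 => .leftEnd
  | i + 1 => match w[i]? with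
    | some x => .letter x
    | none => .rightEnd

/-- The input head cannot leave the positions `0, …, n + 1`. -/
def moveInput (n : ℕ) : Move → ℕ → ℕ
  | .left, i => i - 1
  | .stay, i => i
  | .right, i => min (i + 1) (n + 1)

/-- The work tape has the squares `0, 1, 2, …`; a move to the left of square `0` has no effect. -/
def moveWork : Move → ℕ → ℕ
  | .left, i => i - 1
  | .stay, i => i
  | .right, i => i + 1

namespace Transducer

variable {X Y : Type*}

/-- Configurations of a transducer (the input word is kept apart). -/
structure Cfg (M : Transducer X Y) where
  state : M.Q
  inputPos : ℕ
  work : ℕ → M.Γ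
  workPos : ℕ
  output : List Y

/-- Initially the input head is on the left end marker, and work tape and output are empty. -/
def init (M : Transducer X Y) : M.Cfg where
  state := M.start
  inputPos := 0
  work := fun _ => M.blank
  workPos := 0
  output := []

/-- One step on the input word `w`; the value is `none` if the machine halts. -/
def step (M : Transducer X Y) (w : List X) (C : M.Cfg) : Option M.Cfg :=
  (M.next C.state (readInput w C.inputPos) (C.work C.workPos)).map fun r =>
    { state := r.1
      inputPos := moveInput w.length r.2.2.1 C.inputPos
      work := Function.update C.work C.workPos r.2.1
      workPos := moveWork r.2.2.2.1 C.workPos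
      output := C.output ++ r.2.2.2.2 }

/-- On input `w` the machine halts, with output `v`. -/
def HaltsWith (M : Transducer X Y) (w : List X) (v : List Y) : Prop :=
  ∃ C : M.Cfg, StateTransition.Reaches (M.step w) M.init C ∧ M.step w C = none ∧ C.output = v

/-- During the whole computation on input `w` only the first `s` squares of the work tape are
visited. -/
def SpaceBound (M : Transducer X Y) (w : List X) (s : ℕ) : Prop :=
  ∀ C : M.Cfg, StateTransition.Reaches (M.step w) M.init C → C.workPos < s

end Transducer

/-- `f` is computed by a deterministic transducer that visits at most `c * (⌊log₂ n⌋ + 1)` squares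
of its work tape on inputs of length `n`, where `c` is a constant. (The `+ 1` only matters for
`n ≤ 1`, where `log n` is not positive.) -/
def LogspaceComputable {X Y : Type*} [Finite X] [Finite Y] (f : List X → List Y) : Prop :=
  ∃ (M : Transducer X Y) (c : ℕ), ∀ w : List X,
    M.HaltsWith w (f w) ∧ M.SpaceBound w (c * (Nat.log 2 w.length + 1))

/-! ### Normal forms of groups -/

/-- The group element represented by a word, when the letter `x` stands for `π x`. -/
def wordVal {X G : Type*} [Group G] (π : X → G) (w : List X) : G :=
  (w.map π).prod

/-- A set of words that is in bijection with the group. -/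
def IsNormalForm {X G : Type*} [Group G] (π : X → G) (L : Set (List X)) : Prop :=
  Set.BijOn (wordVal π) L Set.univ

/-- `f` sends every word to the word of `L` that represents the same group element, and is computable
in logspace. -/
def IsLogspaceNormalFormFunction {X G : Type*} [Finite X] [Group G] (π : X → G)
    (L : Set (List X)) (f : List X → List X) : Prop :=
  LogspaceComputable f ∧ ∀ w, f w ∈ L ∧ wordVal π (f w) = wordVal π w

end Logspace

/-! ### The solvable Baumslag–Solitar groups -/

namespace BaumslagSolitar

/-- The two generators. -/
inductive Gen where
  | a : Gen
  | t : Gen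
  deriving DecidableEq

instance : Fintype Gen where
  elems := {Gen.a, Gen.t}
  complete := by rintro ⟨⟩ <;> simp

/-- The symmetric alphabet: `(x, true)` stands for `x` and `(x, false)` for `x⁻¹`. -/
abbrev Letter : Type := Gen × Bool

/-- The relator of the relation `t a t⁻¹ = a ^ p`. -/
def relators (p : ℕ) : Set (FreeGroup Gen) :=
  {FreeGroup.of Gen.t * FreeGroup.of Gen.a * (FreeGroup.of Gen.t)⁻¹ * (FreeGroup.of Gen.a ^ p)⁻¹}

/-- `BS(1,p) = ⟨a, t | t a t⁻¹ = a ^ p⟩`. -/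
abbrev BS (p : ℕ) : Type := PresentedGroup (relators p)

/-- A generator as an element of `BS(1,p)`. -/
def gen (p : ℕ) (x : Gen) : BS p := PresentedGroup.of x

/-- The element of `BS(1,p)` that a letter stands for. -/
def letterVal (p : ℕ) : Letter → BS p
  | (x, true) => gen p x
  | (x, false) => (gen p x)⁻¹

/-- The word `x ^ n` for an integer `n`. -/
def powWord (x : Gen) (n : ℤ) : List Letter :=
  List.replicate n.natAbs (x, decide (0 ≤ n))

/-- The word `(a ^ n) ^ (t ^ α) = t ^ (-α) a ^ n t ^ α`. -/
def conjWord (n α : ℤ) : List Letter :=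
  powWord .t (-α) ++ powWord .a n ++ powWord .t α

/-- A nonempty sequence `(η₀, α₀), …, (η_k, α_k)` with `0 < η_j < p` and `α₀ > … > α_k`. -/
structure Digits (p : ℕ) where
  list : List (ℕ × ℤ)
  ne_nil : list ≠ []
  digit_pos : ∀ d ∈ list, 0 < d.1
  digit_lt : ∀ d ∈ list, d.1 < p
  decreasing : list.Pairwise fun d e => d.2 > e.2

/-- The number `∑ η_j / p ^ α_j`. -/
def Digits.value {p : ℕ} (D : Digits p) : ℚ :=
  (D.list.map fun d => (d.1 : ℚ) / (p : ℚ) ^ d.2).sum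

/-- The parameters of the three kinds of normal form words. -/
inductive NF (p : ℕ) where
  | tpow (i : ℤ) : NF p
  | pos (D : Digits p) (i : ℤ) : NF p
  | neg (D : Digits p) (i : ℤ) : NF p

namespace NF

variable {p : ℕ}

/-- The normal form words: `t ^ i`, and `(a ^ (±η₀)) ^ (t ^ α₀) ⋯ (a ^ (±η_k)) ^ (t ^ α_k) t ^ i` with
the same sign throughout. -/
def word : NF p → List Letter
  | tpow i => powWord .t i
  | pos D i => (D.list.flatMap fun d => conjWord d.1 d.2) ++ powWord .t i
  | neg D i => (D.list.flatMap fun d => conjWord (-d.1) d.2) ++ powWord .t i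

/-- The number with the signed `p`-ary expansion recorded by the parameters. -/
def entry : NF p → ℚ
  | tpow _ => 0
  | pos D _ => D.value
  | neg D _ => -D.value

/-- The exponent `i` of the final power of `t`. -/
def texp : NF p → ℤ
  | tpow i => i
  | pos _ i => i
  | neg _ i => i

end NF

/-- The set of all normal form words. -/
def normalForm (p : ℕ) : Set (List Letter) := Set.range (NF.word (p := p))

end BaumslagSolitar

namespace Logspace

/-! ### Program fragments -/

/-! Algebra. Moving `t` to the right past powers of `a` writes every group element as `t^(-k) a^n
t^i` (`exists_standardElt`). Its matrix has entries `p^(i-k)` and `n/p^k`, which gives both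
faithfulness and the image of the representation `rho`. A normal form word maps to the matrix with
entries `p^i` and `±∑ η_j/p^(α_j)`. The sign of the second entry determines the form, and reduction
modulo `p` at the largest `α` determines the digits one after another (`digitSum_injOn`). So
distinct parameters give distinct elements.

Existence, via the algorithm. In a word `w` of length `n`, a letter `a^(±1)` after a prefix of
`t`-exponent `-z` contributes `±p^(-z)`; collecting these gives the entry `∑ hits w z / p^z`
(`rho_wordVal`). After scaling by `p^n` it is `∑ S_j p^j` with `z = n - j`, `|S_j| ≤ n`, and `S_j =
0` for `j > 2n`. Schoolbook carrying with floor division produces the digits from the lowest power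
up, which is the order of decreasing `α` that the normal form demands. The carries stay bounded by
`n`, and after `3n + 1` rounds the carry is `0` or `-1` (`carrySeq_coeffSeq_final`). If it is `-1`
the entry is negative, and carrying with all signs reversed ends in `0` (`carrySeq_entrySign`).

Logspace. Neither the `S_j` nor the digits are stored: every round scans the input again and adds
the letters at height `0` directly to the carry. What must be remembered is a height, a carry, a
round count and one auxiliary number, all linear in `n`, hence four binary counters. Since the sign
must be known before anything is written, a silent pass finds it and a second pass writes the digits
(`exec_normalProg`). Machines are built from composable fragments, and `Exec` specifies a fragment
by its effect on the counters together with the space it uses. -/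

instance {X : Type*} [Finite X] : Finite (InSym X) :=
  Finite.of_surjective (fun o : Option (Option X) => match o with
    | none => InSym.leftEnd
    | some none => InSym.rightEnd
    | some (some x) => InSym.letter x) (by
    rintro (_ | x | _)
    exacts [⟨none, rfl⟩, ⟨some (some x), rfl⟩, ⟨some none, rfl⟩])

/-- A finite control that ends with an exit value, so that fragments can be composed. -/
structure Frag (X Y Γ E : Type) where
  Q : Type
  finite_Q : Finite Q
  start : Q
  next : Q → InSym X → Γ → (Q × Γ × Move × Move × List Y) ⊕ E

/-- The tapes of a transducer. -/
structure Mem (Y Γ : Type) where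
  inputPos : ℕ
  work : ℕ → Γ
  workPos : ℕ
  output : List Y

/-- The effect of one step on the tapes. -/
def Mem.act {Y Γ : Type} (n : ℕ) (m : Mem Y Γ) (g : Γ) (mi mw : Move) (o : List Y) : Mem Y Γ where
  inputPos := moveInput n mi m.inputPos
  work := Function.update m.work m.workPos g
  workPos := moveWork mw m.workPos
  output := m.output ++ o

namespace Frag

variable {X Y Γ E F S : Type}

/-- From a state and tapes the fragment reaches an exit, visiting only the first `s` squares. -/
inductive Runs (w : List X) (s : ℕ) (M : Frag X Y Γ E) : M.Q → Mem Y Γ → E → Mem Y Γ → Prop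
  | exit {q m e} : m.workPos < s →
      M.next q (readInput w m.inputPos) (m.work m.workPos) = .inr e → Runs w s M q m e m
  | step {q m q' g mi mw o e m'} : m.workPos < s →
      M.next q (readInput w m.inputPos) (m.work m.workPos) = .inl (q', g, mi, mw, o) →
      Runs w s M q' (m.act w.length g mi mw o) e m' → Runs w s M q m e m'

/-- A fragment as a transducer: it halts at every exit. -/
def toTransducer (M : Frag X Y Γ E) [Finite Γ] (blank : Γ) : Transducer X Y where
  Q := M.Q
  Γ := Γ
  finite_Q := M.finite_Q
  finite_Γ := inferInstance
  start := M.start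
  blank := blank
  next q x g := (M.next q x g).elim some fun _ => none

/-- Configurations from states and tapes. -/
def toCfg (M : Frag X Y Γ E) [Finite Γ] (b : Γ) (q : M.Q) (m : Mem Y Γ) :
    (M.toTransducer b).Cfg :=
  ⟨q, m.inputPos, m.work, m.workPos, m.output⟩

/-- The machine is deterministic, so the configurations reachable from the start are exactly those
on the one halting run. Hence the bound recorded along that run is a bound for all of them. -/
theorem Runs.reaches [Finite Γ] {w : List X} {s : ℕ} {M : Frag X Y Γ E} (b : Γ) {q m e m'}
    (h : M.Runs w s q m e m') :
    (∃ C : (M.toTransducer b).Cfg,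
      StateTransition.Reaches ((M.toTransducer b).step w) (M.toCfg b q m) C ∧
        (M.toTransducer b).step w C = none ∧ C.output = m'.output) ∧
    ∀ C : (M.toTransducer b).Cfg,
      StateTransition.Reaches ((M.toTransducer b).step w) (M.toCfg b q m) C → C.workPos < s := by
  induction h with
  | @exit q m e hm he =>
    have hn : (M.toTransducer b).step w (M.toCfg b q m) = none := by
      simp [Transducer.step, toTransducer, toCfg, he]
    refine ⟨⟨_, Relation.ReflTransGen.refl, hn, rfl⟩, fun C hC => ?_⟩
    rcases Relation.ReflTransGen.cases_head hC with rfl | ⟨D, hD, -⟩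
    · exact hm
    · simp [hn] at hD
  | @step q m q' g mi mw o e m' hm he hr ih =>
    have hn : (M.toTransducer b).step w (M.toCfg b q m) =
        some (M.toCfg b q' (m.act w.length g mi mw o)) := by
      simp only [Transducer.step, toTransducer, toCfg, he]
      rfl
    obtain ⟨⟨C, hC, hC'⟩, ih⟩ := ih
    refine ⟨⟨C, hC.head hn, hC'⟩, fun C hC => ?_⟩
    rcases Relation.ReflTransGen.cases_head hC with rfl | ⟨D, hD, hDC⟩
    · exact hm
    · rw [hn] at hD
      obtain rfl := Option.some.inj hD
      exact ih C hDC

/-- The fragment that exits at once. -/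
def ret (e : E) : Frag X Y Γ E where
  Q := Unit
  finite_Q := inferInstance
  start := ()
  next _ _ _ := .inr e

/-- The fragment that exits with the scanned input symbol. -/
def read : Frag X Y Γ (InSym X) where
  Q := Unit
  finite_Q := inferInstance
  start := ()
  next _ x _ := .inr x

/-- The fragment that moves the input head and writes to the output. -/
def emit (mi : Move) (o : List Y) : Frag X Y Γ Unit where
  Q := Bool
  finite_Q := inferInstance
  start := false
  next q _ g := bif q then .inr () else .inl (true, g, mi, .stay, o)

/-- Sequential composition: the exit value of the first fragment selects the second. -/
def bind [Finite E] (M : Frag X Y Γ E) (N : E → Frag X Y Γ F) : Frag X Y Γ F where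
  Q := M.Q ⊕ Σ e, (N e).Q
  finite_Q :=
    have := M.finite_Q
    have := fun e => (N e).finite_Q
    inferInstance
  start := .inl M.start
  next
    | .inl q, x, g => match M.next q x g with
      | .inl r => .inl (.inl r.1, r.2)
      | .inr e => .inl (.inr ⟨e, (N e).start⟩, g, .stay, .stay, [])
    | .inr ⟨e, q⟩, x, g => match (N e).next q x g with
      | .inl r => .inl (.inr ⟨e, r.1⟩, r.2)
      | .inr f => .inr f

/-- Iteration: the body is repeated until it exits with `Sum.inr`. -/
def iter [Finite S] (body : S → Frag X Y Γ (S ⊕ E)) (s : S) : Frag X Y Γ E where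
  Q := Σ s, (body s).Q
  finite_Q :=
    have := fun s => (body s).finite_Q
    inferInstance
  start := ⟨s, (body s).start⟩
  next q x g := match (body q.1).next q.2 x g with
    | .inl r => .inl (⟨q.1, r.1⟩, r.2)
    | .inr (.inl s') => .inl (⟨s', (body s').start⟩, g, .stay, .stay, [])
    | .inr (.inr e) => .inr e

/-- Composition and iteration pass control by a step that writes back the scanned symbol and moves
no head; such a step leaves the tapes as they were. -/
theorem Mem.act_stay {n : ℕ} (m : Mem Y Γ) :
    m.act n (m.work m.workPos) .stay .stay [] = m := by
  simp [Mem.act, moveInput, moveWork]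

variable {w : List X} {s : ℕ}

theorem Runs.bind_right [Finite E] {M : Frag X Y Γ E} {N : E → Frag X Y Γ F} {e q m f m'}
    (h : (N e).Runs w s q m f m') : (M.bind N).Runs w s (.inr ⟨e, q⟩) m f m' := by
  induction h with
  | exit hm he => exact .exit hm (by simp [bind, he])
  | step hm he _ ih => exact .step hm (by simp only [bind, he]) ih

theorem Runs.bind [Finite E] {M : Frag X Y Γ E} {N : E → Frag X Y Γ F} {e q m f m' m''}
    (h : M.Runs w s q m e m') (h' : (N e).Runs w s (N e).start m' f m'') :
    (M.bind N).Runs w s (.inl q) m f m'' := by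
  induction h with
  | exit hm he =>
    refine .step hm (by simp only [Frag.bind, he]; rfl) ?_
    rw [Mem.act_stay]
    exact h'.bind_right
  | step hm he _ ih => exact .step hm (by simp only [Frag.bind, he]) (ih h')

theorem Runs.iter_exit [Finite S] {body : S → Frag X Y Γ (S ⊕ E)} {s₀ s₁ : S} {q m e m'}
    (h : (body s₁).Runs w s q m (.inr e) m') : (iter body s₀).Runs w s ⟨s₁, q⟩ m e m' := by
  generalize hr : (Sum.inr e : S ⊕ E) = r at h
  induction h with
  | exit hm he => subst hr; exact .exit hm (by simp [iter, he])
  | step hm he _ ih => exact .step hm (by simp only [iter, he]) (ih hr)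

theorem Runs.iter_next [Finite S] {body : S → Frag X Y Γ (S ⊕ E)} {s₀ s₁ s₂ : S} {q m e m' m''}
    (h : (body s₁).Runs w s q m (.inl s₂) m')
    (h' : (iter body s₀).Runs w s ⟨s₂, (body s₂).start⟩ m' e m'') :
    (iter body s₀).Runs w s ⟨s₁, q⟩ m e m'' := by
  generalize hr : (Sum.inl s₂ : S ⊕ E) = r at h
  induction h with
  | exit hm he =>
    subst hr
    refine .step hm (by simp only [iter, he]; rfl) ?_
    rw [Mem.act_stay]
    exact h'
  | step hm he _ ih => exact .step hm (by simp only [iter, he]) (ih h' hr)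

/-- The parameter of `iter` only fixes the start state; the transition table is the same for all of
them. -/
theorem Runs.iter_start [Finite S] {body : S → Frag X Y Γ (S ⊕ E)} {s₀ s₁ : S} {q m e m'}
    (h : (iter body s₀).Runs w s q m e m') : (iter body s₁).Runs w s q m e m' := by
  induction h with
  | exit hm he => exact .exit hm he
  | step hm he _ ih => exact .step hm he ih

end Frag

/-! ### Binary counters on the tracks of the work tape -/

/-- The work squares: a mark for square `0` and a binary digit for each counter. -/
abbrev Cell (ι : Type) : Type := Bool × (ι → Option Bool)

/-- The number with the given binary digits, the least significant one first. -/
def bitsVal : List Bool → ℕ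
  | [] => 0
  | b :: l => b.toNat + 2 * bitsVal l

theorem bitsVal_replicate_false (j : ℕ) : bitsVal (List.replicate j false) = 0 := by
  induction j with
  | zero => rfl
  | succ j ih => simp [List.replicate_succ, bitsVal, ih]

theorem bitsVal_replicate_true (j : ℕ) : bitsVal (List.replicate j true) + 1 = 2 ^ j := by
  induction j with
  | zero => rfl
  | succ j ih => simp [List.replicate_succ, bitsVal, pow_succ]; omega

theorem bitsVal_carry (j : ℕ) (l : List Bool) :
    bitsVal (List.replicate j false ++ true :: l) =
      bitsVal (List.replicate j true ++ false :: l) + 1 := by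
  induction j with
  | zero => simp [bitsVal]; omega
  | succ j ih => simp [List.replicate_succ, bitsVal, ih]; omega

theorem bitsVal_carry_nil (j : ℕ) :
    bitsVal (List.replicate j false ++ [true]) = bitsVal (List.replicate j true) + 1 := by
  induction j with
  | zero => simp [bitsVal]
  | succ j ih => simp [List.replicate_succ, bitsVal, ih]; omega

theorem exists_replicate (b : Bool) (l : List Bool) :
    (∃ j, l = List.replicate j b) ∨ ∃ j l', l = List.replicate j b ++ (!b) :: l' := by
  induction l with
  | nil => exact .inl ⟨0, rfl⟩
  | cons c l ih =>
    by_cases hc : c = b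
    · subst hc
      rcases ih with ⟨j, rfl⟩ | ⟨j, l', rfl⟩
      · exact .inl ⟨j + 1, rfl⟩
      · exact .inr ⟨j + 1, l', rfl⟩
    · exact .inr ⟨0, l, by cases b <;> cases c <;> simp_all⟩

variable {X Y ι E F S : Type} [DecidableEq ι]

/-- The work tape that holds the given digits. -/
def tapeOf (bits : ι → List Bool) (i : ℕ) : Cell ι := (decide (i = 0), fun c => (bits c)[i]?)

/-- Overwrite one digit of a work square. -/
def Cell.set (g : Cell ι) (c : ι) (b : Bool) : Cell ι := (g.1, Function.update g.2 c (some b))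

/-- The two alternatives for `v` are appending a new top digit and overwriting an existing one. -/
theorem tapeOf_write (bits : ι → List Bool) (c : ι) (u : List Bool) (b : Bool) (l : List Bool)
    (v : List Bool) (hv : v = u ∧ l = [] ∨ ∃ b', v = u ++ b' :: l) :
    Function.update (tapeOf (Function.update bits c v)) u.length
      ((tapeOf (Function.update bits c v) u.length).set c b) =
      tapeOf (Function.update bits c (u ++ b :: l)) := by
  funext i
  by_cases hi : i = u.length
  · subst hi
    simp only [Function.update_self, tapeOf, Cell.set]
    congr 1
    funext d
    by_cases hd : d = c
    · subst hd; simp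
    · simp [hd]
  · rw [Function.update_of_ne hi]
    simp only [tapeOf]
    congr 1
    funext d
    by_cases hd : d = c
    · subst hd
      simp only [Function.update_self]
      rcases hv with ⟨rfl, rfl⟩ | ⟨b', rfl⟩
      · rcases lt_or_gt_of_ne hi with h | h
        · simp [List.getElem?_append_left h]
        · rw [List.getElem?_eq_none h.le, List.getElem?_eq_none (by simp; omega)]
      · rcases lt_or_gt_of_ne hi with h | h
        · simp [List.getElem?_append_left h]
        · obtain ⟨k, rfl⟩ := Nat.exists_eq_add_of_lt h
          simp [List.getElem?_append_right, add_assoc]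
    · simp [hd]

end Logspace

namespace Logspace
variable {X Y ι E F S : Type} [DecidableEq ι]

/-! ### Incrementing and decrementing a binary counter -/

namespace Frag

/-- Write the mark into square `0`. -/
def mark : Frag X Y (Cell ι) Unit where
  Q := Bool
  finite_Q := inferInstance
  start := false
  next q _ g := bif q then .inr () else .inl (true, (true, g.2), .stay, .stay, [])

/-- Increase a counter. In state `false` the head moves to the right and propagates the carry, in
state `true` it returns to the mark. -/
def inc (c : ι) : Frag X Y (Cell ι) Unit where
  Q := Bool
  finite_Q := inferInstance
  start := false
  next
    | false, _, g =>
      if g.2 c = some true then .inl (false, g.set c false, .stay, .right, [])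
      else .inl (true, g.set c true, .stay, .stay, [])
    | true, _, g => if g.1 then .inr () else .inl (true, g, .stay, .left, [])

/-- Decrease a counter unless it is zero; the exit value tells whether it was not. In state
`inl false` the head looks for the lowest digit `1`, in state `inl true` it returns and replaces the
digits `0` by `1`, in state `inr b` it returns to the mark and changes nothing. -/
def dec (c : ι) : Frag X Y (Cell ι) Bool where
  Q := Bool ⊕ Bool
  finite_Q := inferInstance
  start := .inl false
  next
    | .inl false, _, g =>
      match g.2 c with
      | none => .inl (.inr false, g, .stay, .stay, [])
      | some false => .inl (.inl false, g, .stay, .right, [])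
      | some true => if g.1 then .inl (.inr true, g.set c false, .stay, .stay, [])
        else .inl (.inl true, g.set c false, .stay, .left, [])
    | .inl true, _, g => if g.1 then .inl (.inr true, g.set c true, .stay, .stay, [])
        else .inl (.inl true, g.set c true, .stay, .left, [])
    | .inr b, _, g => if g.1 then .inr b else .inl (.inr b, g, .stay, .left, [])

variable {w : List X} {s : ℕ}

theorem inc_next_true {c : ι} (x : InSym X) {g : Cell ι} (h : g.2 c = some true) :
    (inc c : Frag X Y (Cell ι) Unit).next false x g =
      .inl (false, g.set c false, .stay, .right, []) := if_pos h

theorem inc_next_false {c : ι} (x : InSym X) {g : Cell ι} (h : g.2 c ≠ some true) :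
    (inc c : Frag X Y (Cell ι) Unit).next false x g =
      .inl (true, g.set c true, .stay, .stay, []) := if_neg h

theorem dec_next_none {c : ι} (x : InSym X) {g : Cell ι} (h : g.2 c = none) :
    (dec c : Frag X Y (Cell ι) Bool).next (.inl false) x g =
      .inl (.inr false, g, .stay, .stay, []) := by
  simp only [dec, h]

theorem dec_next_false {c : ι} (x : InSym X) {g : Cell ι} (h : g.2 c = some false) :
    (dec c : Frag X Y (Cell ι) Bool).next (.inl false) x g =
      .inl (.inl false, g, .stay, .right, []) := by
  simp only [dec, h]

theorem dec_next_true_mark {c : ι} (x : InSym X) {g : Cell ι} (h : g.2 c = some true)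
    (hg : g.1 = true) : (dec c : Frag X Y (Cell ι) Bool).next (.inl false) x g =
      .inl (.inr true, g.set c false, .stay, .stay, []) := by
  simp only [dec, h, hg, if_true]

theorem dec_next_true {c : ι} (x : InSym X) {g : Cell ι} (h : g.2 c = some true)
    (hg : g.1 = false) : (dec c : Frag X Y (Cell ι) Bool).next (.inl false) x g =
      .inl (.inl true, g.set c false, .stay, .left, []) := by
  simp [dec, h, hg]

theorem dec_next_fill_mark {c : ι} (x : InSym X) {g : Cell ι} (hg : g.1 = true) :
    (dec c : Frag X Y (Cell ι) Bool).next (.inl true) x g =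
      .inl (.inr true, g.set c true, .stay, .stay, []) := by
  simp [dec, hg]

theorem dec_next_fill {c : ι} (x : InSym X) {g : Cell ι} (hg : g.1 = false) :
    (dec c : Frag X Y (Cell ι) Bool).next (.inl true) x g =
      .inl (.inl true, g.set c true, .stay, .left, []) := by
  simp [dec, hg]

omit [DecidableEq ι] in
theorem runs_keep {M : Frag X Y (Cell ι) E} {q : M.Q} {q' : M.Q} {bits : ι → List Bool}
    {p i : ℕ} {o : List Y} {mw : Move} {e m'} (hi : i < s)
    (hq : M.next q (readInput w p) (tapeOf bits i) = .inl (q', tapeOf bits i, .stay, mw, []))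
    (h : M.Runs w s q' ⟨p, tapeOf bits, moveWork mw i, o⟩ e m') :
    M.Runs w s q ⟨p, tapeOf bits, i, o⟩ e m' := by
  refine .step hi hq ?_
  simpa [Mem.act, moveInput] using h

theorem runs_set {M : Frag X Y (Cell ι) E} {q : M.Q} {q' : M.Q} {bits : ι → List Bool} {c : ι}
    (u : List Bool) {b : Bool} (l : List Bool) {v : List Bool}
    (hv : v = u ∧ l = [] ∨ ∃ b', v = u ++ b' :: l)
    {p i : ℕ} {o : List Y} {mw : Move} {e m'} (hi : i < s) (hu : u.length = i)
    (hq : M.next q (readInput w p) (tapeOf (Function.update bits c v) i) =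
      .inl (q', (tapeOf (Function.update bits c v) i).set c b, .stay, mw, []))
    (h : M.Runs w s q' ⟨p, tapeOf (Function.update bits c (u ++ b :: l)), moveWork mw i, o⟩ e m') :
    M.Runs w s q ⟨p, tapeOf (Function.update bits c v), i, o⟩ e m' := by
  subst hu
  refine .step hi hq ?_
  simpa [Mem.act, moveInput, tapeOf_write bits c u b l v hv] using h

-- A left move on square `0` has no visible effect, so the mark is what tells the head that it is
-- back.
omit [DecidableEq ι] in
theorem runs_return {M : Frag X Y (Cell ι) E} {q : M.Q} {e : E}
    (hq : ∀ x g, M.next q x g = if g.1 then .inr e else .inl (q, g, .stay, .left, []))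
    (bits : ι → List Bool) (p i : ℕ) (o : List Y) (hi : i < s) :
    M.Runs w s q ⟨p, tapeOf bits, i, o⟩ e ⟨p, tapeOf bits, 0, o⟩ := by
  induction i with
  | zero => exact .exit hi (by simp [hq, tapeOf])
  | succ i ih =>
    refine runs_keep hi ((hq _ _).trans (if_neg ?_)) (ih (by omega))
    simp [tapeOf]

/-- Invariant of the carry: `i` digits `1` have been turned into `0` and `j` are still ahead. They
are followed either by the end of the number, which then grows by a digit, or by a `0` that absorbs
the carry. -/
theorem runs_inc_carry (bits : ι → List Bool) (c : ι) (p : ℕ) (o : List Y) (l l' : List Bool)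
    (hl : l = [] ∧ l' = [] ∨ l = false :: l') (j i : ℕ) (hs : i + j < s) :
    (inc c : Frag X Y (Cell ι) Unit).Runs w s false
      ⟨p, tapeOf (Function.update bits c
        (List.replicate i false ++ (List.replicate j true ++ l))), i, o⟩ ()
      ⟨p, tapeOf (Function.update bits c
        (List.replicate (i + j) false ++ true :: l')), 0, o⟩ := by
  induction j generalizing i with
  | zero =>
    refine runs_set (List.replicate i false) l' ?_ hs (by simp) (inc_next_false _ ?_)
      (runs_return (fun x g => rfl) _ _ _ _ hs)
    · rcases hl with ⟨rfl, rfl⟩ | rfl <;> simp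
    · rcases hl with ⟨rfl, rfl⟩ | rfl <;> simp [tapeOf]
  | succ j ih =>
    refine runs_set (List.replicate i false) (List.replicate j true ++ l) ?_ (by omega)
      (by simp) (inc_next_true _ ?_) ?_
    · exact .inr ⟨true, by simp [List.replicate_succ]⟩
    · simp [tapeOf, List.replicate_succ]
    · have := ih (i + 1) (by omega)
      rw [show i + 1 + j = i + (j + 1) by omega, List.replicate_succ' (n := i), List.append_assoc]
        at this
      exact this

/-- The second half of a borrow: once the lowest `1` is erased, the zeros below it become ones on
the way back. -/
theorem runs_dec_fill (bits : ι → List Bool) (c : ι) (p : ℕ) (o : List Y) (i : ℕ) (l : List Bool)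
    (hs : i < s) :
    (dec c : Frag X Y (Cell ι) Bool).Runs w s (.inl true)
      ⟨p, tapeOf (Function.update bits c (List.replicate (i + 1) false ++ l)), i, o⟩ true
      ⟨p, tapeOf (Function.update bits c (List.replicate (i + 1) true ++ l)), 0, o⟩ := by
  induction i generalizing l with
  | zero =>
    exact runs_set [] l (.inr ⟨false, rfl⟩) hs rfl (dec_next_fill_mark _ rfl)
      (runs_return (fun x g => rfl) _ _ _ _ hs)
  | succ i ih =>
    refine runs_set (List.replicate (i + 1) false) l
      (.inr ⟨false, by rw [List.replicate_succ' (n := i + 1)]; simp⟩) hs (by simp)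
      (dec_next_fill _ (by simp [tapeOf])) ?_
    rw [List.replicate_succ' (n := i + 1) (a := true), List.append_assoc]
    exact ih (true :: l) (by omega)

theorem runs_dec_scan (bits : ι → List Bool) {k i : ℕ} (c : ι) (p : ℕ) (o : List Y) {e m'}
    {l : List Bool} (hb : bits c = List.replicate k false ++ l) (hs : k < s)
    (h : (dec c : Frag X Y (Cell ι) Bool).Runs w s (.inl false) ⟨p, tapeOf bits, k, o⟩ e m')
    (hi : i ≤ k) :
    (dec c : Frag X Y (Cell ι) Bool).Runs w s (.inl false) ⟨p, tapeOf bits, i, o⟩ e m' := by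
  induction hi using Nat.decreasingInduction with
  | self => exact h
  | of_succ i hi ih =>
    refine runs_keep (by omega) (dec_next_false _ ?_) ih
    simp only [tapeOf]
    rw [hb, List.getElem?_append_left (by simpa using hi)]
    simp [hi]

end Frag

/-! ### Counter states -/

/-- The position of the input head, the values of the counters and the output. -/
structure Store (ι Y : Type) where
  pos : ℕ
  cnt : ι → ℕ
  out : List Y

/-- The tapes hold the counters, with at most `B` binary digits each. -/
def Store.Rep (B : ℕ) (σ : Store ι Y) (m : Mem Y (Cell ι)) : Prop :=
  ∃ bits : ι → List Bool, (∀ c, bitsVal (bits c) = σ.cnt c ∧ (bits c).length ≤ B) ∧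
    m = ⟨σ.pos, tapeOf bits, 0, σ.out⟩

/-- Started with counters of at most `B` digits, the fragment reaches the exit `e` with the given
counters, again of at most `B` digits, and visits only the first `B + 1` squares. -/
def Exec (w : List X) (B : ℕ) (M : Frag X Y (Cell ι) E) (σ : Store ι Y) (e : E)
    (σ' : Store ι Y) : Prop :=
  ∀ m, σ.Rep B m → ∃ m', σ'.Rep B m' ∧ M.Runs w (B + 1) M.start m e m'

variable {w : List X} {B : ℕ}

omit [DecidableEq ι] in
theorem Exec.ret (e : E) (σ : Store ι Y) : Exec w B (Frag.ret e) σ e σ := by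
  rintro m ⟨bits, hb, rfl⟩
  exact ⟨_, ⟨bits, hb, rfl⟩, .exit (by simp) rfl⟩

omit [DecidableEq ι] in
theorem Exec.read (i : ℕ) (s : ι → ℕ) (o : List Y) :
    Exec w B Frag.read ⟨i, s, o⟩ (readInput w i) ⟨i, s, o⟩ := by
  rintro m ⟨bits, hb, rfl⟩
  exact ⟨_, ⟨bits, hb, rfl⟩, .exit (by simp) rfl⟩

omit [DecidableEq ι] in
theorem Exec.emit (mi : Move) (o' : List Y) (i : ℕ) (s : ι → ℕ) (o : List Y) :
    Exec w B (Frag.emit mi o') ⟨i, s, o⟩ () ⟨moveInput w.length mi i, s, o ++ o'⟩ := by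
  rintro m ⟨bits, hb, rfl⟩
  refine ⟨_, ⟨bits, hb, rfl⟩, .step (by simp) rfl ?_⟩
  simp only [Mem.act, moveWork, Function.update_eq_self]
  exact .exit (by simp) rfl

omit [DecidableEq ι] in
theorem Exec.bind [Finite E] {M : Frag X Y (Cell ι) E} {N : E → Frag X Y (Cell ι) F} {e f}
    {σ σ' σ'' : Store ι Y} (h : Exec w B M σ e σ') (h' : Exec w B (N e) σ' f σ'') :
    Exec w B (M.bind N) σ f σ'' := by
  intro m hm
  obtain ⟨m', hm', hr⟩ := h m hm
  obtain ⟨m'', hm'', hr'⟩ := h' m' hm'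
  exact ⟨m'', hm'', hr.bind hr'⟩

omit [DecidableEq ι] in
theorem Exec.iter_exit [Finite S] {body : S → Frag X Y (Cell ι) (S ⊕ E)} {s : S} {e}
    {σ σ' : Store ι Y} (h : Exec w B (body s) σ (.inr e) σ') :
    Exec w B (Frag.iter body s) σ e σ' := by
  intro m hm
  obtain ⟨m', hm', hr⟩ := h m hm
  exact ⟨m', hm', hr.iter_exit⟩

omit [DecidableEq ι] in
theorem Exec.iter_next [Finite S] {body : S → Frag X Y (Cell ι) (S ⊕ E)} {s s' : S} {e}
    {σ σ' σ'' : Store ι Y} (h : Exec w B (body s) σ (.inl s') σ')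
    (h' : Exec w B (Frag.iter body s') σ' e σ'') :
    Exec w B (Frag.iter body s) σ e σ'' := by
  intro m hm
  obtain ⟨m', hm', hr⟩ := h m hm
  obtain ⟨m'', hm'', hr'⟩ := h' m' hm'
  exact ⟨m'', hm'', hr.iter_next hr'.iter_start⟩

theorem Exec.inc (c : ι) (i : ℕ) (s : ι → ℕ) (o : List Y) (hs : s c + 1 < 2 ^ B) :
    Exec w B (Frag.inc c) ⟨i, s, o⟩ () ⟨i, Function.update s c (s c + 1), o⟩ := by
  rintro m ⟨bits, hb, rfl⟩
  have key : ∀ l l' : List Bool, ∀ j, (l = [] ∧ l' = [] ∨ l = false :: l') →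
      bits c = List.replicate j true ++ l →
      ∃ m', Store.Rep B ⟨i, Function.update s c (s c + 1), o⟩ m' ∧
        (Frag.inc c : Frag X Y (Cell ι) Unit).Runs w (B + 1) false ⟨i, tapeOf bits, 0, o⟩ () m' := by
    intro l l' j hl hj
    have hlen : j ≤ B := by
      have := (hb c).2
      rw [hj] at this
      simp at this
      omega
    refine ⟨_, ⟨Function.update bits c (List.replicate (0 + j) false ++ true :: l'), ?_, rfl⟩, ?_⟩
    · intro d
      by_cases hd : d = c
      · subst hd
        have hv : _ = s d := (hb d).1
        have hL := (hb d).2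
        simp only [Function.update_self, zero_add]
        rw [hj] at hv hL
        rcases hl with ⟨rfl, rfl⟩ | rfl
        · refine ⟨by rw [bitsVal_carry_nil, ← hv, List.append_nil], ?_⟩
          -- Only here does the number grow: it consists of `j` ones, so its successor `2 ^ j < 2 ^
          -- B` leaves room for one more digit.
          rw [← hv, List.append_nil, bitsVal_replicate_true] at hs
          have := (Nat.pow_lt_pow_iff_right (by norm_num)).1 hs
          simpa using this
        · refine ⟨by rw [bitsVal_carry, ← hv], by simpa using hL⟩
      · simpa [hd] using hb d
    · have := Frag.runs_inc_carry (w := w) (s := B + 1) bits c i o l l' hl j 0 (by omega)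
      rwa [List.replicate_zero, List.nil_append, ← hj, Function.update_eq_self] at this
  rcases exists_replicate true (bits c) with ⟨j, hj⟩ | ⟨j, l', hj⟩
  · exact key [] [] j (.inl ⟨rfl, rfl⟩) (by simpa using hj)
  · exact key _ l' j (.inr rfl) hj

/-- Decrementing never shortens a digit list, so zero may be stored as any string of digits `0`; the
scan recognises it by running off its end. -/
theorem Exec.dec_zero (c : ι) (i : ℕ) (s : ι → ℕ) (o : List Y) (hs : s c = 0) :
    Exec w B (Frag.dec c) ⟨i, s, o⟩ false ⟨i, s, o⟩ := by
  rintro m ⟨bits, hb, rfl⟩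
  refine ⟨_, ⟨bits, hb, rfl⟩, ?_⟩
  have hv := hb c
  simp only [hs] at hv
  rcases exists_replicate false (bits c) with ⟨j, hj⟩ | ⟨j, l', hj⟩
  · rw [hj] at hv
    have hjB : j ≤ B := by simpa using hv.2
    exact Frag.runs_dec_scan bits c i o (k := j) (l := []) (by simpa using hj) (by omega)
      (Frag.runs_keep (by omega) (Frag.dec_next_none _ (by simp [tapeOf, hj]))
        (Frag.runs_return (fun x g => rfl) _ _ _ _ (by simp only [moveWork]; omega))) (Nat.zero_le _)
  · rw [hj, Bool.not_false, bitsVal_carry] at hv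
    omega

theorem Exec.dec_succ (c : ι) (i : ℕ) (s : ι → ℕ) (o : List Y) (k : ℕ) (hs : s c = k + 1) :
    Exec w B (Frag.dec c) ⟨i, s, o⟩ true ⟨i, Function.update s c k, o⟩ := by
  rintro m ⟨bits, hb, rfl⟩
  have hv := hb c
  simp only [hs] at hv
  rcases exists_replicate false (bits c) with ⟨j, hj⟩ | ⟨j, l, hj⟩
  · rw [hj, bitsVal_replicate_false] at hv
    omega
  · rw [hj, Bool.not_false, bitsVal_carry] at hv
    have hjB : j < B := by have := hv.2; simp at this; omega
    refine ⟨_, ⟨Function.update bits c (List.replicate j true ++ false :: l), ?_, rfl⟩, ?_⟩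
    · intro d
      by_cases hd : d = c
      · subst hd
        simpa using hv
      · simpa [hd] using hb d
    · have hself : bits = Function.update bits c (List.replicate j false ++ true :: l) := by
        rw [← Bool.not_false, ← hj, Function.update_eq_self]
      refine Frag.runs_dec_scan bits c i o (k := j) hj (by omega) ?_ (Nat.zero_le _)
      rw [hself, Function.update_idem]
      -- If the lowest `1` is in square `0`, there are no zeros to refill and the head is already
      -- home.
      rcases j with _ | j
      · exact Frag.runs_set [] l (.inr ⟨true, rfl⟩) (by omega) rfl
          (Frag.dec_next_true_mark _ (by simp [tapeOf]) rfl)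
          (Frag.runs_return (fun x g => rfl) _ _ _ _ (by simp [moveWork]))
      · refine Frag.runs_set (List.replicate (j + 1) false) l (.inr ⟨true, rfl⟩)
          (by omega) (by simp) (Frag.dec_next_true _ (by simp [tapeOf]) (by simp [tapeOf])) ?_
        exact Frag.runs_dec_fill _ c i o j (false :: l) (by simp; omega)

omit [DecidableEq ι] in
/-- Halting computation of the transducer from an execution of the fragment after the mark is
written. -/
theorem Exec.haltsWith [Finite ι] {M : Frag X Y (Cell ι) E} {e : E} {σ' : Store ι Y}
    (h : Exec w B M ⟨0, fun _ => 0, []⟩ e σ') :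
    ((Frag.mark.bind fun _ => M).toTransducer (false, fun _ => none)).HaltsWith w σ'.out ∧
    ((Frag.mark.bind fun _ => M).toTransducer (false, fun _ => none)).SpaceBound w (B + 1) := by
  obtain ⟨m', ⟨bits, hb, rfl⟩, hr⟩ := h ⟨0, tapeOf fun _ => [], 0, []⟩
    ⟨fun _ => [], by simp [bitsVal], rfl⟩
  -- The blank tape differs from the tape of empty counters only by the missing mark in square `0`.
  have h0 : (Frag.mark : Frag X Y (Cell ι) Unit).Runs w (B + 1) false
      ⟨0, fun _ => (false, fun _ => none), 0, []⟩ () ⟨0, tapeOf fun _ => [], 0, []⟩ := by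
    refine .step (by simp) rfl ?_
    have : Mem.act w.length (⟨0, fun _ => (false, fun _ => none), 0, []⟩ : Mem Y (Cell ι))
        (true, fun _ => none) .stay .stay [] = ⟨0, tapeOf fun _ => [], 0, []⟩ := by
      simp only [Mem.act, moveInput, moveWork, List.append_nil, Mem.mk.injEq, true_and, and_true]
      funext i
      by_cases hi : i = 0
      · subst hi; simp [tapeOf]
      · simp [hi, tapeOf]
    rw [this]
    exact .exit (by simp) rfl
  exact (h0.bind (N := fun _ => M) hr).reaches (false, fun _ => none)

end Logspace

namespace BaumslagSolitar
open Logspace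

/-! ### The matrix representation -/

/-- The matrix with the given upper left and upper right entries and lower row `(0, 1)`. -/
def affineMat (x m : ℚ) : Matrix (Fin 2) (Fin 2) ℚ := !![x, m; 0, 1]

theorem affineMat_mul (x m y n : ℚ) :
    affineMat x m * affineMat y n = affineMat (x * y) (x * n + m) := by
  simp [affineMat]

theorem affineMat_one : affineMat 1 0 = 1 := by
  simp [affineMat, Matrix.one_fin_two]

theorem affineMat_inj {x m y n : ℚ} : affineMat x m = affineMat y n ↔ x = y ∧ m = n := by
  constructor
  · intro h
    exact ⟨by simpa [affineMat] using congrFun (congrFun h 0) 0,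
      by simpa [affineMat] using congrFun (congrFun h 0) 1⟩
  · rintro ⟨rfl, rfl⟩
    rfl

/-- Invertible matrices with lower row `(0, 1)`. -/
def affineUnit (x m : ℚ) (hx : x ≠ 0) : (Matrix (Fin 2) (Fin 2) ℚ)ˣ where
  val := affineMat x m
  inv := affineMat x⁻¹ (-(x⁻¹ * m))
  val_inv := by rw [affineMat_mul, ← affineMat_one, affineMat_inj]; field_simp; simp
  inv_val := by rw [affineMat_mul, ← affineMat_one, affineMat_inj]; field_simp; simp

section

variable (p : ℕ) [NeZero p]

/-- The matrices of the generators. -/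
def genUnit : Gen → (Matrix (Fin 2) (Fin 2) ℚ)ˣ
  | .a => affineUnit 1 1 one_ne_zero
  | .t => affineUnit p 0 (Nat.cast_ne_zero.2 (NeZero.ne p))

theorem affineUnit_one_pow (n : ℕ) :
    ((affineUnit 1 1 one_ne_zero ^ n : (Matrix (Fin 2) (Fin 2) ℚ)ˣ) : Matrix (Fin 2) (Fin 2) ℚ) =
      affineMat 1 n := by
  induction n with
  | zero => simp [affineMat_one]
  | succ n ih =>
    rw [pow_succ, Units.val_mul, ih]
    simp [affineUnit, affineMat_mul, add_comm]

theorem lift_genUnit_relators : ∀ r ∈ relators p, FreeGroup.lift (genUnit p) r = 1 := by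
  rintro r rfl
  have h : affineUnit (p : ℚ) 0 (Nat.cast_ne_zero.2 (NeZero.ne p)) * affineUnit 1 1 one_ne_zero =
      affineUnit 1 1 one_ne_zero ^ p * affineUnit (p : ℚ) 0 (Nat.cast_ne_zero.2 (NeZero.ne p)) := by
    ext1
    rw [Units.val_mul, Units.val_mul, affineUnit_one_pow]
    simp [affineUnit, affineMat_mul]
  simp only [map_mul, map_inv, map_pow, FreeGroup.lift_apply_of, genUnit, h]
  group

/-- The representation of `BS(1,p)` by matrices. -/
def rho : BS p →* Matrix (Fin 2) (Fin 2) ℚ :=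
  (Units.coeHom _).comp (PresentedGroup.toGroup (lift_genUnit_relators p))

theorem rho_t : rho p (gen p .t) = affineMat p 0 := by
  simp [rho, gen, genUnit, affineUnit]

theorem rho_a : rho p (gen p .a) = affineMat 1 1 := by
  simp [rho, gen, genUnit, affineUnit]

/-- The target is only a monoid, so the inverse is identified by uniqueness of two-sided inverses.
-/
theorem rho_inv {g : BS p} {x m : ℚ} (hx : x ≠ 0) (h : rho p g = affineMat x m) :
    rho p g⁻¹ = affineMat x⁻¹ (-(x⁻¹ * m)) := by
  have h1 : rho p g⁻¹ * affineMat x m = 1 := by rw [← h, ← map_mul]; simp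
  have h2 : affineMat x m * affineMat x⁻¹ (-(x⁻¹ * m)) = 1 := (affineUnit x m hx).val_inv
  exact left_inv_eq_right_inv h1 h2

theorem rho_t_zpow (i : ℤ) : rho p (gen p .t ^ i) = affineMat ((p : ℚ) ^ i) 0 := by
  have hp : (p : ℚ) ≠ 0 := Nat.cast_ne_zero.2 (NeZero.ne p)
  have hn (n : ℕ) : rho p (gen p .t ^ n) = affineMat ((p : ℚ) ^ n) 0 := by
    induction n with
    | zero => simp [affineMat_one]
    | succ n ih => rw [pow_succ, map_mul, ih, rho_t, affineMat_mul]; simp [pow_succ]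
  obtain ⟨n, rfl | rfl⟩ := i.eq_nat_or_neg
  · simpa using hn n
  · rw [zpow_neg, zpow_natCast, rho_inv p (pow_ne_zero n hp) (hn n)]
    simp

theorem rho_a_zpow (i : ℤ) : rho p (gen p .a ^ i) = affineMat 1 i := by
  have hn (n : ℕ) : rho p (gen p .a ^ n) = affineMat 1 n := by
    induction n with
    | zero => simp [affineMat_one]
    | succ n ih => rw [pow_succ, map_mul, ih, rho_a, affineMat_mul]; simp [add_comm]
  obtain ⟨n, rfl | rfl⟩ := i.eq_nat_or_neg
  · simpa using hn n
  · rw [zpow_neg, zpow_natCast, rho_inv p one_ne_zero (hn n)]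
    simp

theorem rho_conj (α n : ℤ) : rho p (gen p .t ^ (-α) * gen p .a ^ n * gen p .t ^ α) =
    affineMat 1 (n / (p : ℚ) ^ α) := by
  have hp : (p : ℚ) ≠ 0 := Nat.cast_ne_zero.2 (NeZero.ne p)
  simp only [map_mul, rho_t_zpow, rho_a_zpow, affineMat_mul]
  congr 1
  · simp [zpow_ne_zero α hp]
  · simp [zpow_neg, div_eq_inv_mul]

/-! ### Commuting `t` past `a`, and standard elements -/

omit [NeZero p] in
theorem t_mul_a_zpow (n : ℤ) : gen p .t * gen p .a ^ n = gen p .a ^ (p * n) * gen p .t := by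
  have h : gen p .t * gen p .a * (gen p .t)⁻¹ = gen p .a ^ p := by
    have h1 : (PresentedGroup.mk (relators p)) (FreeGroup.of Gen.t * FreeGroup.of Gen.a *
        (FreeGroup.of Gen.t)⁻¹ * (FreeGroup.of Gen.a ^ p)⁻¹) = 1 :=
      PresentedGroup.one_of_mem rfl
    simp only [map_mul, map_inv, map_pow] at h1
    exact mul_inv_eq_one.1 h1
  have h2 : (gen p .t * gen p .a * (gen p .t)⁻¹) ^ n = gen p .a ^ (p * n) := by
    rw [h, zpow_mul, zpow_natCast]
  rw [conj_zpow] at h2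
  rw [← h2]
  group

omit [NeZero p] in
theorem t_pow_mul_a_zpow (k : ℕ) (n : ℤ) :
    gen p .t ^ k * gen p .a ^ n = gen p .a ^ (p ^ k * n) * gen p .t ^ k := by
  induction k with
  | zero => simp
  | succ k ih =>
    rw [pow_succ', mul_assoc, ih, ← mul_assoc, t_mul_a_zpow, mul_assoc, pow_succ',
      mul_assoc (p : ℤ)]

/-- Every element is of this form. -/
def standardElt (k : ℕ) (n i : ℤ) : BS p := gen p .t ^ (-k : ℤ) * gen p .a ^ n * gen p .t ^ i

omit [NeZero p] in
theorem a_zpow_mul_standardElt (e : ℤ) (k : ℕ) (n i : ℤ) :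
    gen p .a ^ e * standardElt p k n i = standardElt p k (p ^ k * e + n) i := by
  have h : gen p .a ^ e * gen p .t ^ (-k : ℤ) = gen p .t ^ (-k : ℤ) * gen p .a ^ (p ^ k * e) := by
    rw [zpow_neg, eq_inv_mul_iff_mul_eq, ← mul_assoc, zpow_natCast, t_pow_mul_a_zpow]
    group
  simp only [standardElt, ← mul_assoc, h]
  simp only [mul_assoc, zpow_add]

omit [NeZero p] in
theorem t_mul_standardElt (k : ℕ) (n i : ℤ) :
    gen p .t * standardElt p k n i = standardElt p k (p * n) (i + 1) := by
  have h : gen p .t * gen p .t ^ (-k : ℤ) = gen p .t ^ (-k : ℤ) * gen p .t := by group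
  simp only [standardElt, ← mul_assoc, h]
  rw [mul_assoc (gen p .t ^ (-k : ℤ)), t_mul_a_zpow, zpow_add, zpow_one]
  group

omit [NeZero p] in
theorem t_inv_mul_standardElt (k : ℕ) (n i : ℤ) :
    (gen p .t)⁻¹ * standardElt p k n i = standardElt p (k + 1) n i := by
  simp only [standardElt]
  push_cast
  group

-- The standard elements contain `1` and are stable under left multiplication by the generators and
-- their inverses. Multiplying by `t⁻¹` merely raises `k`, so no divisibility of `n` is ever needed.
omit [NeZero p] in
theorem exists_standardElt (g : BS p) : ∃ k n i, g = standardElt p k n i := by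
  have hmem : g ∈ Subgroup.closure (Set.range (gen p)) := by
    have := PresentedGroup.closure_range_of (relators p)
    exact this ▸ Subgroup.mem_top g
  induction hmem using Subgroup.closure_induction_left with
  | one => exact ⟨0, 0, 0, by simp [standardElt]⟩
  | mul_left x hx y hy ih =>
    obtain ⟨k, n, i, rfl⟩ := ih
    obtain ⟨_ | _, rfl⟩ := hx
    · exact ⟨_, _, _, by rw [← a_zpow_mul_standardElt p 1, zpow_one]⟩
    · exact ⟨_, _, _, t_mul_standardElt p k n i⟩
  | inv_mul_cancel x hx y hy ih =>
    obtain ⟨k, n, i, rfl⟩ := ih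
    obtain ⟨_ | _, rfl⟩ := hx
    · exact ⟨_, _, _, by rw [← a_zpow_mul_standardElt p (-1), zpow_neg, zpow_one]⟩
    · exact ⟨_, _, _, t_inv_mul_standardElt p k n i⟩

theorem rho_standardElt (k : ℕ) (n i : ℤ) :
    rho p (standardElt p k n i) = affineMat ((p : ℚ) ^ (i - k)) (n / (p : ℚ) ^ k) := by
  have hp : (p : ℚ) ≠ 0 := Nat.cast_ne_zero.2 (NeZero.ne p)
  have : standardElt p k n i =
      gen p .t ^ (-k : ℤ) * gen p .a ^ n * gen p .t ^ (k : ℤ) * gen p .t ^ (i - k) := by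
    rw [standardElt]
    group
  rw [this, map_mul, rho_conj, rho_t_zpow, affineMat_mul]
  simp

theorem mem_adjoin_inv_iff (m : ℚ) :
    m ∈ Algebra.adjoin ℤ {(p : ℚ)⁻¹} ↔ ∃ (k : ℕ) (n : ℤ), m = n / (p : ℚ) ^ k := by
  have hp : (p : ℚ) ≠ 0 := Nat.cast_ne_zero.2 (NeZero.ne p)
  constructor
  · intro h
    induction h using Algebra.adjoin_induction with
    | mem x hx =>
      obtain rfl := hx
      exact ⟨1, 1, by simp⟩
    | algebraMap r => exact ⟨0, r, by simp⟩
    | add x y _ _ hx hy =>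
      obtain ⟨k, n, rfl⟩ := hx
      obtain ⟨l, m, rfl⟩ := hy
      exact ⟨k + l, n * p ^ l + m * p ^ k, by push_cast; field_simp; ring⟩
    | mul x y _ _ hx hy =>
      obtain ⟨k, n, rfl⟩ := hx
      obtain ⟨l, m, rfl⟩ := hy
      exact ⟨k + l, n * m, by push_cast; field_simp; ring⟩
  · rintro ⟨k, n, rfl⟩
    rw [div_eq_mul_inv, ← inv_pow]
    have h1 : (n : ℚ) ∈ Algebra.adjoin ℤ {(p : ℚ)⁻¹} := by simp
    have h2 : (p : ℚ)⁻¹ ∈ Algebra.adjoin ℤ {(p : ℚ)⁻¹} := Algebra.subset_adjoin rfl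
    exact Subalgebra.mul_mem _ h1 (Subalgebra.pow_mem _ h2 k)

theorem range_rho : Set.range (rho p) = {A | ∃ i : ℤ, ∃ m ∈ Algebra.adjoin ℤ {(p : ℚ)⁻¹},
    A = !![(p : ℚ) ^ i, m; 0, 1]} := by
  ext A
  constructor
  · rintro ⟨g, rfl⟩
    obtain ⟨k, n, i, rfl⟩ := exists_standardElt p g
    exact ⟨i - k, n / (p : ℚ) ^ k, (mem_adjoin_inv_iff p _).2 ⟨k, n, rfl⟩, rho_standardElt p k n i⟩
  · rintro ⟨i, m, hm, rfl⟩
    obtain ⟨k, n, rfl⟩ := (mem_adjoin_inv_iff p _).1 hm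
    exact ⟨standardElt p k n (i + k), by rw [rho_standardElt]; simp [affineMat]⟩

variable {p} in
omit [NeZero p] in
theorem zpow_right_inj_of_two_le (hp : 2 ≤ p) {i j : ℤ} (h : (p : ℚ) ^ i = (p : ℚ) ^ j) :
    i = j :=
  zpow_right_injective₀ (by exact_mod_cast (by omega : 0 < p)) (by exact_mod_cast (by omega : p ≠ 1)) h

theorem rho_injective (hp : 2 ≤ p) : Function.Injective (rho p) := by
  rw [injective_iff_map_eq_one]
  intro g hg
  obtain ⟨k, n, i, rfl⟩ := exists_standardElt p g
  have hp0 : (p : ℚ) ≠ 0 := Nat.cast_ne_zero.2 (NeZero.ne p)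
  rw [rho_standardElt, ← affineMat_one, affineMat_inj] at hg
  have h1 : i - k = 0 := zpow_right_inj_of_two_le hp (by simpa using hg.1)
  have h2 : n = 0 := by
    have := hg.2
    field_simp at this
    exact_mod_cast this
  obtain rfl : i = k := by omega
  subst h2
  simp [standardElt]

/-! ### The values of words -/

theorem wordVal_append {X G : Type*} [Group G] (π : X → G) (u v : List X) :
    wordVal π (u ++ v) = wordVal π u * wordVal π v := by
  simp [wordVal]

omit [NeZero p] in
theorem wordVal_powWord (x : Gen) (n : ℤ) :
    wordVal (letterVal p) (powWord x n) = gen p x ^ n := by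
  obtain ⟨n, rfl | rfl⟩ := n.eq_nat_or_neg
  · simp [wordVal, powWord, letterVal]
  · rcases n with _ | n
    · simp [wordVal, powWord]
    · have : ¬ (0 : ℤ) ≤ -((n + 1 : ℕ) : ℤ) := by omega
      simp only [wordVal, powWord, decide_eq_false this, letterVal, Int.natAbs_neg,
        Int.natAbs_natCast, List.map_replicate, List.prod_replicate, inv_pow, zpow_neg,
        zpow_natCast]

theorem rho_conjWord (n α : ℤ) :
    rho p (wordVal (letterVal p) (conjWord n α)) = affineMat 1 (n / (p : ℚ) ^ α) := by
  rw [conjWord, wordVal_append, wordVal_append]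
  simp only [wordVal_powWord]
  exact rho_conj p α n

theorem rho_flatMap_conjWord (e : ℤ) (l : List (ℕ × ℤ)) :
    rho p (wordVal (letterVal p) (l.flatMap fun d => conjWord (e * d.1) d.2)) =
      affineMat 1 (e * (l.map fun d => (d.1 : ℚ) / (p : ℚ) ^ d.2).sum) := by
  induction l with
  | nil => simp [wordVal, affineMat_one]
  | cons d l ih =>
    rw [List.flatMap_cons, wordVal_append, map_mul, ih, rho_conjWord, affineMat_mul]
    simp only [one_mul, List.map_cons, List.sum_cons]
    congr 1
    push_cast
    ring

theorem rho_word (N : NF p) :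
    rho p (wordVal (letterVal p) N.word) = affineMat ((p : ℚ) ^ N.texp) N.entry := by
  have h (e : ℤ) (l : List (ℕ × ℤ)) (i : ℤ) : rho p (wordVal (letterVal p)
      ((l.flatMap fun d => conjWord (e * d.1) d.2) ++ powWord .t i)) =
      affineMat ((p : ℚ) ^ i) (e * (l.map fun d => (d.1 : ℚ) / (p : ℚ) ^ d.2).sum) := by
    rw [wordVal_append, map_mul, rho_flatMap_conjWord, wordVal_powWord, rho_t_zpow, affineMat_mul]
    simp
  rcases N with i | ⟨D, i⟩ | ⟨D, i⟩
  · simpa [NF.word, NF.texp, NF.entry] using h 1 [] i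
  · simpa [NF.word, NF.texp, NF.entry, Digits.value] using h 1 D.list i
  · simpa [NF.word, NF.texp, NF.entry, Digits.value] using h (-1) D.list i

/-! ### Uniqueness of expansions -/

/-- The number with the given digits. -/
def digitSum (l : List (ℕ × ℤ)) : ℚ := (l.map fun d => (d.1 : ℚ) / (p : ℚ) ^ d.2).sum

/-- A sequence of nonzero digits at decreasing negated exponents. -/
def IsDigitList (l : List (ℕ × ℤ)) : Prop :=
  (∀ d ∈ l, 0 < d.1 ∧ d.1 < p) ∧ l.Pairwise fun d e => d.2 > e.2

theorem digitSum_pos {l : List (ℕ × ℤ)} (hl : IsDigitList p l) (hne : l ≠ []) :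
    0 < digitSum p l := by
  have hp : (0 : ℚ) < p := Nat.cast_pos.2 (NeZero.pos p)
  refine List.sum_pos _ ?_ (by simpa using hne)
  simp only [List.mem_map]
  rintro x ⟨d, hd, rfl⟩
  have : (0 : ℚ) < d.1 := Nat.cast_pos.2 (hl.1 d hd).1
  positivity

/-- The largest exponent that occurs is the only denominator to be cleared. -/
theorem exists_digitSum_mul {l : List (ℕ × ℤ)} {β : ℤ} (hβ : ∀ d ∈ l, d.2 ≤ β) :
    ∃ n : ℤ, digitSum p l * (p : ℚ) ^ β = n := by
  have hp : (p : ℚ) ≠ 0 := Nat.cast_ne_zero.2 (NeZero.ne p)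
  induction l with
  | nil => exact ⟨0, by simp [digitSum]⟩
  | cons d l ih =>
    obtain ⟨n, hn⟩ := ih fun e he => hβ e (List.mem_cons_of_mem _ he)
    obtain ⟨k, hk⟩ := Int.eq_ofNat_of_zero_le (sub_nonneg.2 (hβ d List.mem_cons_self))
    refine ⟨d.1 * p ^ k + n, ?_⟩
    rw [show digitSum p (d :: l) = d.1 / (p : ℚ) ^ d.2 + digitSum p l from rfl, add_mul, hn]
    obtain rfl : β = d.2 + k := by omega
    rw [zpow_add₀ hp]
    push_cast
    field_simp
    simp

theorem exists_digitSum_cons {d : ℕ × ℤ} {l : List (ℕ × ℤ)} (hl : IsDigitList p (d :: l)) :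
    ∃ n : ℤ, digitSum p (d :: l) * (p : ℚ) ^ d.2 = d.1 + p * n := by
  have hp : (p : ℚ) ≠ 0 := Nat.cast_ne_zero.2 (NeZero.ne p)
  obtain ⟨n, hn⟩ := exists_digitSum_mul p (l := l) (β := d.2 - 1) (fun e he => by
    have := (List.pairwise_cons.1 hl.2).1 e he
    omega)
  refine ⟨n, ?_⟩
  rw [show digitSum p (d :: l) = d.1 / (p : ℚ) ^ d.2 + digitSum p l from rfl, add_mul, ← hn,
    zpow_sub_one₀ hp]
  field_simp

/-- Scaling by `p ^ (d.2 - 1)` makes the right side an integer, while integrality of the left side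
would force `p ∣ d.1`, against `0 < d.1 < p`. -/
theorem digitSum_cons_ne {d e : ℕ × ℤ} {l m : List (ℕ × ℤ)} (hl : IsDigitList p (d :: l))
    (hm : IsDigitList p (e :: m)) (h : e.2 < d.2) : digitSum p (d :: l) ≠ digitSum p (e :: m) := by
  have hp : (p : ℚ) ≠ 0 := Nat.cast_ne_zero.2 (NeZero.ne p)
  intro heq
  obtain ⟨n, hn⟩ := exists_digitSum_cons p hl
  obtain ⟨k, hk⟩ := exists_digitSum_mul p (l := e :: m) (β := d.2 - 1) (by
    rintro x hx
    rcases List.mem_cons.1 hx with rfl | hx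
    · omega
    · have := (List.pairwise_cons.1 hm.2).1 x hx
      omega)
  rw [← heq, zpow_sub_one₀ hp, ← mul_assoc, hn, ← div_eq_mul_inv, div_eq_iff hp] at hk
  have h1 : (d.1 : ℤ) + p * n = k * p := by exact_mod_cast hk
  have h2 : (p : ℤ) ∣ d.1 := ⟨k - n, by linarith⟩
  have h3 := hl.1 d List.mem_cons_self
  exact absurd (Nat.le_of_dvd h3.1 (Int.natCast_dvd_natCast.1 h2)) (by omega)

/-- The leading exponents agree by `digitSum_cons_ne`; after scaling, the leading digits agree
modulo `p`, hence are equal, and can be cancelled. -/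
theorem digitSum_injOn {l m : List (ℕ × ℤ)} (hl : IsDigitList p l) (hm : IsDigitList p m)
    (h : digitSum p l = digitSum p m) : l = m := by
  have hp : (p : ℚ) ≠ 0 := Nat.cast_ne_zero.2 (NeZero.ne p)
  induction l generalizing m with
  | nil =>
    by_contra hne
    exact (digitSum_pos p hm (Ne.symm hne)).ne h
  | cons d l ih =>
    rcases m with _ | ⟨e, m⟩
    · exact absurd h (digitSum_pos p hl (by simp)).ne'
    rcases lt_trichotomy d.2 e.2 with hlt | heq | hlt
    · exact absurd h.symm (digitSum_cons_ne p hm hl hlt)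
    · obtain ⟨n, hn⟩ := exists_digitSum_cons p hl
      obtain ⟨k, hk⟩ := exists_digitSum_cons p hm
      rw [h, heq, hk] at hn
      have h1 : (e.1 : ℤ) + p * k = d.1 + p * n := by exact_mod_cast hn
      have h2 : d.1 = e.1 := by
        have hd := (hl.1 d List.mem_cons_self).2
        have he := (hm.1 e List.mem_cons_self).2
        have h3 : ((d.1 : ℕ) : ℤ) ≡ (e.1 : ℕ) [ZMOD p] :=
          Int.modEq_iff_dvd.2 ⟨n - k, by linarith⟩
        exact Nat.ModEq.eq_of_lt_of_lt (Int.natCast_modEq_iff.1 h3) hd he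
      obtain rfl : d = e := Prod.ext h2 heq
      congr 1
      refine ih ⟨fun x hx => hl.1 x (List.mem_cons_of_mem _ hx), hl.2.of_cons⟩
        ⟨fun x hx => hm.1 x (List.mem_cons_of_mem _ hx), hm.2.of_cons⟩ ?_
      exact add_left_cancel (a := (d.1 : ℚ) / (p : ℚ) ^ d.2) h
    · exact absurd h (digitSum_cons_ne p hl hm hlt)

variable {p}

omit [NeZero p] in
theorem Digits.isDigitList (D : Digits p) : IsDigitList p D.list :=
  ⟨fun d hd => ⟨D.digit_pos d hd, D.digit_lt d hd⟩, D.decreasing⟩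

omit [NeZero p] in
theorem Digits.ext_list {D D' : Digits p} (h : D.list = D'.list) : D = D' := by
  cases D
  cases D'
  simpa using h

theorem Digits.value_pos (D : Digits p) : 0 < D.value := digitSum_pos p D.isDigitList D.ne_nil

theorem Digits.value_injective {D D' : Digits p} (h : D.value = D'.value) : D = D' :=
  Digits.ext_list (digitSum_injOn p D.isDigitList D'.isDigitList h)

/-- Digit values are positive, so the three forms correspond to zero, positive and negative entries.
-/
theorem NF.ext_entry {N N' : NF p} (hi : N.texp = N'.texp) (he : N.entry = N'.entry) :
    N = N' := by
  rcases N with i | ⟨D, i⟩ | ⟨D, i⟩ <;> rcases N' with i' | ⟨D', i'⟩ | ⟨D', i'⟩ <;>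
    simp only [NF.texp, NF.entry, neg_inj] at hi he <;> subst hi
  · rfl
  · exact absurd he D'.value_pos.ne
  · have := D'.value_pos; linarith
  · exact absurd he D.value_pos.ne'
  · rw [Digits.value_injective he]
  · have := D'.value_pos; have := D.value_pos; linarith
  · have := D.value_pos; linarith
  · have := D'.value_pos; have := D.value_pos; linarith
  · rw [Digits.value_injective he]

theorem wordVal_word_injective (hp : 2 ≤ p) :
    Function.Injective fun N : NF p => wordVal (letterVal p) N.word := by
  intro N N' h
  have h' := congrArg (rho p) h
  simp only [rho_word, affineMat_inj] at h'
  exact NF.ext_entry (zpow_right_inj_of_two_le hp h'.1) h'.2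

omit [NeZero p] in
theorem wordVal_surjective (g : BS p) : ∃ w, wordVal (letterVal p) w = g := by
  obtain ⟨k, n, i, rfl⟩ := exists_standardElt p g
  exact ⟨powWord .t (-k : ℤ) ++ powWord .a n ++ powWord .t i, by
    simp only [wordVal_append, wordVal_powWord, standardElt]⟩

end

end BaumslagSolitar

namespace BaumslagSolitar
open Logspace

/-! ### The `p`-ary expansion of the matrix entry of a word -/

/-- The exponent of a letter. -/
def boolSign (b : Bool) : ℤ := if b then 1 else -1

theorem natAbs_boolSign (b : Bool) : (boolSign b).natAbs = 1 := by cases b <;> rfl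

/-- The exponent of `t` in a letter. -/
def letterExp : Letter → ℤ
  | (.t, b) => boolSign b
  | (.a, _) => 0

/-- The exponent of `a` in a letter that is read at height `z` if `z = 0`. -/
def letterHit : Letter → ℤ → ℤ
  | (.t, _), _ => 0
  | (.a, b), z => if z = 0 then boolSign b else 0

/-- The exponent sum of `t`. -/
def tExp : List Letter → ℤ
  | [] => 0
  | x :: w => letterExp x + tExp w

/-- The exponent sum of those letters `a` that are read at height `0` if one starts at height `z`. -/
def hits : List Letter → ℤ → ℤ
  | [], _ => 0
  | x :: w, z => letterHit x z + hits w (z + letterExp x)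

theorem natAbs_letterExp_le (x : Letter) : (letterExp x).natAbs ≤ 1 := by
  rcases x with ⟨_ | _, _ | _⟩ <;> decide

theorem natAbs_letterHit_le (x : Letter) (z : ℤ) : (letterHit x z).natAbs ≤ 1 := by
  rcases x with ⟨_ | _, b⟩
  · simp only [letterHit]
    split
    · exact (natAbs_boolSign b).le
    · simp
  · simp [letterHit]

theorem tExp_append (u v : List Letter) : tExp (u ++ v) = tExp u + tExp v := by
  induction u with
  | nil => simp [tExp]
  | cons x u ih => simp only [List.cons_append, tExp, ih, add_assoc]

theorem tExp_singleton (x : Letter) : tExp [x] = letterExp x := by simp [tExp]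

theorem hits_append_singleton (u : List Letter) (x : Letter) (z : ℤ) :
    hits (u ++ [x]) z = hits u z + letterHit x (z + tExp u) := by
  induction u generalizing z with
  | nil => simp [hits, tExp]
  | cons y u ih => simp only [List.cons_append, hits, tExp, ih, add_assoc]

theorem natAbs_tExp_le (w : List Letter) : (tExp w).natAbs ≤ w.length := by
  induction w with
  | nil => simp [tExp]
  | cons x w ih =>
    have := natAbs_letterExp_le x
    simp only [tExp, List.length_cons]
    omega

theorem natAbs_hits_le (w : List Letter) (z : ℤ) : (hits w z).natAbs ≤ w.length := by
  induction w generalizing z with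
  | nil => simp [hits]
  | cons x w ih =>
    have := natAbs_letterHit_le x z
    have := ih (z + letterExp x)
    simp only [hits, List.length_cons]
    omega

theorem hits_eq_zero {w : List Letter} {z : ℤ} (h : w.length < z.natAbs) : hits w z = 0 := by
  induction w generalizing z with
  | nil => rfl
  | cons x w ih =>
    have hx := natAbs_letterExp_le x
    simp only [List.length_cons] at h
    rw [hits, ih (by omega)]
    rcases x with ⟨_ | _, b⟩
    · simp only [letterHit]
      rw [if_neg (by omega)]
      rfl
    · rfl

/-- Appending `a^(±1)` adds `±p ^ tExp w` to the entry, and appending a power of `t` leaves the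
entry alone. `T` may be any set that contains all heights a word of this length can hit, so it stays
fixed during the induction. -/
theorem rho_wordVal (p : ℕ) [NeZero p] (w : List Letter) (T : Finset ℤ)
    (hT : ∀ z : ℤ, z.natAbs ≤ w.length → z ∈ T) :
    rho p (wordVal (letterVal p) w) =
      affineMat ((p : ℚ) ^ tExp w) (∑ z ∈ T, (hits w z : ℚ) / (p : ℚ) ^ z) := by
  have hp : (p : ℚ) ≠ 0 := Nat.cast_ne_zero.2 (NeZero.ne p)
  induction w using List.reverseRecOn with
  | nil => simp [wordVal, tExp, hits, affineMat_one]
  | append_singleton w x ih =>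
    rw [wordVal_append, map_mul, ih fun z hz => hT z (by simp; omega), tExp_append, tExp_singleton,
      zpow_add₀ hp]
    simp only [hits_append_singleton]
    have hpow (g : Gen) (b : Bool) :
        wordVal (letterVal p) [(g, b)] = gen p g ^ boolSign b := by
      cases b <;> simp [wordVal, letterVal, boolSign]
    rcases x with ⟨_ | _, b⟩
    · rw [hpow, rho_a_zpow, affineMat_mul]
      congr 1
      push_cast
      simp only [add_div, Finset.sum_add_distrib]
      rw [add_comm]
      congr 1
      -- The new letter is read at height `0` for exactly one starting height.
      rw [Finset.sum_eq_single_of_mem (-tExp w)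
        (hT _ (by have := natAbs_tExp_le w; simp; omega))]
      · simp [letterHit, mul_comm]
      · intro z _ hz
        simp only [letterHit]
        rw [if_neg (by omega)]
        simp
    · rw [hpow, rho_t_zpow, affineMat_mul]
      simp [letterExp, letterHit]

/-! ### Carries -/

/-- The carries in the computation of the base `p` digits of `∑ S j * p ^ j`. -/
def carrySeq (p : ℕ) (S : ℕ → ℤ) : ℕ → ℤ
  | 0 => 0
  | j + 1 => (carrySeq p S j + S j) / p

/-- The base `p` digits of `∑ S j * p ^ j`. -/
def digitSeq (p : ℕ) (S : ℕ → ℤ) (j : ℕ) : ℕ := ((carrySeq p S j + S j) % p).toNat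

theorem natCast_digitSeq {p : ℕ} (hp : 2 ≤ p) (S : ℕ → ℤ) (j : ℕ) :
    (digitSeq p S j : ℤ) = (carrySeq p S j + S j) % p :=
  Int.toNat_of_nonneg (Int.emod_nonneg _ (by omega))

theorem digitSeq_lt {p : ℕ} (hp : 2 ≤ p) (S : ℕ → ℤ) (j : ℕ) : digitSeq p S j < p := by
  have := Int.emod_lt_of_pos (carrySeq p S j + S j) (b := p) (by omega)
  rw [← natCast_digitSeq hp] at this
  omega

/-- Division with remainder in each position; the carries telescope. -/
theorem sum_mul_pow_eq {p : ℕ} (hp : 2 ≤ p) (S : ℕ → ℤ) (N : ℕ) :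
    ∑ j ∈ Finset.range N, S j * (p : ℤ) ^ j =
      ∑ j ∈ Finset.range N, (digitSeq p S j : ℤ) * (p : ℤ) ^ j + carrySeq p S N * (p : ℤ) ^ N := by
  induction N with
  | zero => simp [carrySeq]
  | succ N ih =>
    rw [Finset.sum_range_succ, Finset.sum_range_succ, ih, natCast_digitSeq hp, carrySeq, pow_succ]
    have := Int.mul_ediv_add_emod (carrySeq p S N + S N) p
    linear_combination (-(p : ℤ) ^ N) * this

theorem sum_digitSeq_lt {p : ℕ} (hp : 2 ≤ p) (S : ℕ → ℤ) (N : ℕ) :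
    ∑ j ∈ Finset.range N, (digitSeq p S j : ℤ) * (p : ℤ) ^ j < (p : ℤ) ^ N := by
  induction N with
  | zero => simp
  | succ N ih =>
    rw [Finset.sum_range_succ, pow_succ]
    have h : (digitSeq p S N : ℤ) + 1 ≤ p := by exact_mod_cast digitSeq_lt hp S N
    have hpos : (0 : ℤ) ≤ (p : ℤ) ^ N := by positivity
    have := mul_le_mul_of_nonneg_right h hpos
    linarith

theorem ediv_le_of_le {p : ℕ} (hp : 2 ≤ p) {v m : ℤ} (hm : 0 ≤ m) (h : v ≤ 2 * m + 1) :
    v / p ≤ m := by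
  have h2 : (m + 1) * 2 ≤ (m + 1) * p :=
    mul_le_mul_of_nonneg_left (by exact_mod_cast hp) (by omega)
  exact Int.lt_add_one_iff.1 (Int.ediv_lt_of_lt_mul (by omega) (by linarith))

theorem le_ediv_of_le {p : ℕ} (hp : 2 ≤ p) {v m : ℤ} (hm : m ≤ 0) (h : 2 * m ≤ v) : m ≤ v / p := by
  have h2 : (p : ℤ) * m ≤ 2 * m := mul_le_mul_of_nonpos_right (by exact_mod_cast hp) hm
  exact (Int.le_ediv_iff_mul_le (by omega)).2 (by linarith)

/-- Carry plus coefficient is at most `2 * n` in absolute value, and dividing by `p ≥ 2` at least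
halves it. This is why the carry fits into a logarithmic counter. -/
theorem natAbs_carrySeq_le {p : ℕ} (hp : 2 ≤ p) {S : ℕ → ℤ} {n : ℕ}
    (hS : ∀ j, (S j).natAbs ≤ n) (j : ℕ) : (carrySeq p S j).natAbs ≤ n := by
  induction j with
  | zero => simp [carrySeq]
  | succ j ih =>
    have := hS j
    have h1 : (carrySeq p S j + S j) / p ≤ n := ediv_le_of_le hp (by omega) (by omega)
    have h2 : -(n : ℤ) ≤ (carrySeq p S j + S j) / p := le_ediv_of_le hp (by omega) (by omega)
    rw [carrySeq]
    omega

/-- Once the coefficients vanish, each floor division brings the carry closer to `0` or `-1`, the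
fixed points of floor division; the interval that confines it shrinks by one at each end per step,
so `n` steps suffice. -/
theorem carrySeq_eventually {p : ℕ} (hp : 2 ≤ p) {S : ℕ → ℤ} {n M : ℕ}
    (hS : ∀ j, (S j).natAbs ≤ n) (hM : ∀ j, M ≤ j → S j = 0) :
    carrySeq p S (M + n) = 0 ∨ carrySeq p S (M + n) = -1 := by
  have key (i : ℕ) (hi : i ≤ n) :
      -1 - ((n : ℤ) - i) ≤ carrySeq p S (M + i) ∧ carrySeq p S (M + i) ≤ (n : ℤ) - i := by
    induction i with
    | zero =>
      have := natAbs_carrySeq_le hp hS (M + 0)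
      simp only [Nat.cast_zero]
      omega
    | succ i ih =>
      have ih := ih (by omega)
      rw [← add_assoc, carrySeq, hM _ (by omega), add_zero]
      push_cast
      exact ⟨le_ediv_of_le hp (by omega) (by omega), ediv_le_of_le hp (by omega) (by omega)⟩
  have := key n le_rfl
  omega

/-! ### The expansion of a word -/

variable (p : ℕ) (w : List Letter)

/-- The coefficients of the expansion of the signed matrix entry, lowest power first. -/
def coeffSeq (e : Bool) (j : ℕ) : ℤ := boolSign e * hits w ((w.length : ℤ) - j)

theorem natAbs_coeffSeq_le (e : Bool) (j : ℕ) : (coeffSeq w e j).natAbs ≤ w.length := by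
  rw [coeffSeq, Int.natAbs_mul, natAbs_boolSign, one_mul]
  exact natAbs_hits_le _ _

theorem carrySeq_coeffSeq_final {p : ℕ} (hp : 2 ≤ p) (e : Bool) :
    carrySeq p (coeffSeq w e) (3 * w.length + 1) = 0 ∨
      carrySeq p (coeffSeq w e) (3 * w.length + 1) = -1 := by
  have := carrySeq_eventually hp (natAbs_coeffSeq_le w e) (M := 2 * w.length + 1) (fun j hj => by
    rw [coeffSeq, hits_eq_zero (by omega), mul_zero])
  rwa [show 2 * w.length + 1 + w.length = 3 * w.length + 1 by ring] at this

/-- Whether the matrix entry is nonnegative. -/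
def entrySign : Bool := decide (0 ≤ carrySeq p (coeffSeq w true) (3 * w.length + 1))

/-- The digits below position `N` sum to less than `p ^ N`, so a final carry `-1` means a negative
number. A number and its negative cannot both be negative. -/
theorem carrySeq_entrySign {p : ℕ} (hp : 2 ≤ p) :
    carrySeq p (coeffSeq w (entrySign p w)) (3 * w.length + 1) = 0 := by
  rcases carrySeq_coeffSeq_final w hp true with h | h
  · simp [entrySign, h]
  · have he : entrySign p w = false := by simp [entrySign, h]
    rw [he]
    refine (carrySeq_coeffSeq_final w hp false).resolve_right fun h' => ?_
    have h1 := sum_mul_pow_eq hp (coeffSeq w true) (3 * w.length + 1)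
    have h2 := sum_mul_pow_eq hp (coeffSeq w false) (3 * w.length + 1)
    have h3 := sum_digitSeq_lt hp (coeffSeq w true) (3 * w.length + 1)
    have h4 := sum_digitSeq_lt hp (coeffSeq w false) (3 * w.length + 1)
    rw [h] at h1
    rw [h'] at h2
    have h5 : ∑ j ∈ Finset.range (3 * w.length + 1), coeffSeq w false j * (p : ℤ) ^ j =
        -∑ j ∈ Finset.range (3 * w.length + 1), coeffSeq w true j * (p : ℤ) ^ j := by
      rw [← Finset.sum_neg_distrib]
      exact Finset.sum_congr rfl fun j _ => by simp [coeffSeq, boolSign]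
    linarith

/-- The nonzero digits with their negated exponents. -/
def digitList : List (ℕ × ℤ) :=
  ((List.range (3 * w.length + 1)).map fun j =>
    (digitSeq p (coeffSeq w (entrySign p w)) j, (w.length : ℤ) - j)).filter fun d => d.1 ≠ 0

theorem isDigitList_digitList {p : ℕ} (hp : 2 ≤ p) : IsDigitList p (digitList p w) := by
  constructor
  · intro d hd
    simp only [digitList, List.mem_filter, List.mem_map] at hd
    obtain ⟨⟨j, _, rfl⟩, hj⟩ := hd
    exact ⟨Nat.pos_of_ne_zero (by simpa using hj), digitSeq_lt hp _ _⟩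
  · refine List.Pairwise.filter _ (List.pairwise_map.2 (List.pairwise_lt_range.imp fun h => ?_))
    simpa using h

theorem digitSum_filter [NeZero p] (l : List (ℕ × ℤ)) :
    digitSum p (l.filter fun d => d.1 ≠ 0) = digitSum p l := by
  induction l with
  | nil => rfl
  | cons d l ih =>
    have hcons (l) : digitSum p (d :: l) = d.1 / (p : ℚ) ^ d.2 + digitSum p l := rfl
    by_cases hd : d.1 = 0
    · rw [List.filter_cons_of_neg (by simpa using hd), ih, hcons, hd]
      simp
    · rw [List.filter_cons_of_pos (by simpa using hd), hcons, hcons, ih]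

theorem flatMap_filter_eq {α β : Type*} (q : α → Bool) (f : α → List β) (l : List α) :
    (l.filter q).flatMap f = l.flatMap fun x => if q x then f x else [] := by
  induction l with
  | nil => rfl
  | cons x l ih =>
    by_cases hx : q x
    · simp [hx, ih]
    · simp [hx, ih]

/-- The word of the normal form. -/
def normalWord : List Letter :=
  ((digitList p w).flatMap fun d => conjWord (boolSign (entrySign p w) * d.1) d.2) ++
    powWord .t (tExp w)

theorem normalWord_mem {p : ℕ} (hp : 2 ≤ p) : normalWord p w ∈ normalForm p := by
  by_cases hne : digitList p w = []
  · exact ⟨.tpow (tExp w), by simp [NF.word, normalWord, hne]⟩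
  · have hD := isDigitList_digitList w hp
    let D : Digits p := ⟨digitList p w, hne, fun d hd => (hD.1 d hd).1, fun d hd => (hD.1 d hd).2,
      hD.2⟩
    cases he : entrySign p w
    · exact ⟨.neg D (tExp w), by simp [NF.word, normalWord, he, boolSign, D]⟩
    · exact ⟨.pos D (tExp w), by simp [NF.word, normalWord, he, boolSign, D]⟩

theorem digitSum_digitList {p : ℕ} [NeZero p] (hp : 2 ≤ p) :
    boolSign (entrySign p w) * digitSum p (digitList p w) =
      ∑ z ∈ (Finset.range (3 * w.length + 1)).image fun j : ℕ => (w.length : ℤ) - j,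
        (hits w z : ℚ) / (p : ℚ) ^ z := by
  have hp0 : (p : ℚ) ≠ 0 := Nat.cast_ne_zero.2 (NeZero.ne p)
  have h1 := sum_mul_pow_eq hp (coeffSeq w (entrySign p w)) (3 * w.length + 1)
  rw [carrySeq_entrySign w hp, zero_mul, add_zero] at h1
  -- The sign occurs twice: in front of the digit sum and inside the coefficients.
  have hs : (boolSign (entrySign p w) : ℚ) * boolSign (entrySign p w) = 1 := by
    cases entrySign p w <;> simp [boolSign]
  have hpow (x : ℚ) (j : ℕ) :
      x / (p : ℚ) ^ ((w.length : ℤ) - j) = x * (p : ℚ) ^ j / (p : ℚ) ^ w.length := by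
    rw [zpow_sub₀ hp0, zpow_natCast, zpow_natCast]
    field_simp
  rw [Finset.sum_image (fun x _ y _ h => by simpa using h), digitList, digitSum_filter, digitSum,
    List.map_map, Function.comp_def, ← List.sum_toFinset _ List.nodup_range, List.toFinset_range]
  simp only [hpow, ← Finset.sum_div]
  rw [← mul_div_assoc]
  congr 1
  have h2 := congrArg (Int.cast (R := ℚ)) h1
  push_cast at h2
  rw [← h2, Finset.mul_sum]
  refine Finset.sum_congr rfl fun j _ => ?_
  rw [coeffSeq]
  push_cast
  linear_combination (hits w ((w.length : ℤ) - j) : ℚ) * (p : ℚ) ^ j * hs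

theorem wordVal_normalWord {p : ℕ} (hp : 2 ≤ p) :
    wordVal (letterVal p) (normalWord p w) = wordVal (letterVal p) w := by
  have : NeZero p := ⟨by omega⟩
  apply rho_injective p hp
  rw [rho_wordVal p w ((Finset.range (3 * w.length + 1)).image fun j : ℕ => (w.length : ℤ) - j),
    ← digitSum_digitList w hp, normalWord, wordVal_append, map_mul, rho_flatMap_conjWord,
    wordVal_powWord, rho_t_zpow, affineMat_mul]
  · simp [digitSum]
  · intro z hz
    simp only [Finset.mem_image, Finset.mem_range]
    -- Heights between `-n` and `n` correspond to positions `j ≤ 2 * n`, which are in the range.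
    exact ⟨((w.length : ℤ) - z).toNat, by omega, by omega⟩

end BaumslagSolitar

namespace BaumslagSolitar
open Logspace

/-! ### Signed counters -/

/-- The counters of the program: a height, a carry, the number of remaining rounds, and an
auxiliary counter. -/
inductive Ctr where
  | height : Ctr
  | carry : Ctr
  | rounds : Ctr
  | aux : Ctr
  deriving DecidableEq

instance : Finite Ctr :=
  Finite.of_surjective (fun i : Fin 4 => match i with
    | 0 => Ctr.height
    | 1 => Ctr.carry
    | 2 => Ctr.rounds
    | 3 => Ctr.aux) (by
    rintro (_ | _ | _ | _)
    exacts [⟨0, rfl⟩, ⟨1, rfl⟩, ⟨2, rfl⟩, ⟨3, rfl⟩])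

/-- Fragments that work on words over the symmetric alphabet. -/
abbrev Prog (E : Type) : Type 1 := Frag Letter Letter (Cell Ctr) E

/-- The counter values. -/
def cnts (h k r x : ℕ) : Ctr → ℕ
  | .height => h
  | .carry => k
  | .rounds => r
  | .aux => x

@[simp] theorem cnts_height (h k r x : ℕ) : cnts h k r x .height = h := rfl
@[simp] theorem cnts_carry (h k r x : ℕ) : cnts h k r x .carry = k := rfl
@[simp] theorem cnts_rounds (h k r x : ℕ) : cnts h k r x .rounds = r := rfl
@[simp] theorem cnts_aux (h k r x : ℕ) : cnts h k r x .aux = x := rfl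

@[simp] theorem update_height (h k r x v : ℕ) :
    Function.update (cnts h k r x) .height v = cnts v k r x := by
  funext c; cases c <;> rfl
@[simp] theorem update_carry (h k r x v : ℕ) :
    Function.update (cnts h k r x) .carry v = cnts h v r x := by
  funext c; cases c <;> rfl
@[simp] theorem update_rounds (h k r x v : ℕ) :
    Function.update (cnts h k r x) .rounds v = cnts h k v x := by
  funext c; cases c <;> rfl
@[simp] theorem update_aux (h k r x v : ℕ) :
    Function.update (cnts h k r x) .aux v = cnts h k r v := by
  funext c; cases c <;> rfl

/-- An integer `z` is stored as the bit `0 ≤ z` in the finite control and this number on the tape. -/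
def mag (z : ℤ) : ℕ := if 0 ≤ z then z.toNat else (-z - 1).toNat

/-- The sign bit. -/
abbrev nonneg (z : ℤ) : Bool := decide (0 ≤ z)

theorem mag_le (z : ℤ) : mag z ≤ z.natAbs := by
  unfold mag
  split <;> omega

variable {w : List Letter} {B : ℕ}

/-- Add one to a signed counter if `up`, subtract one otherwise; `s` is the sign bit. -/
def step (c : Ctr) (up s : Bool) : Prog Bool :=
  if s = up then (Frag.inc c).bind fun _ => Frag.ret s
  else (Frag.dec c).bind fun b => Frag.ret (bif b then s else up)

/-- `0` and `-1` have the same magnitude `0`, so crossing between them is a failed decrement that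
only flips the sign bit. -/
theorem exec_step (c : Ctr) (up : Bool) (z : ℤ) (i : ℕ) (s : Ctr → ℕ) (o : List Letter)
    (hs : s c = mag z) (hB : mag z + 1 < 2 ^ B) :
    Exec w B (step c up (nonneg z)) ⟨i, s, o⟩ (nonneg (z + boolSign up))
      ⟨i, Function.update s c (mag (z + boolSign up)), o⟩ := by
  unfold step
  by_cases h : nonneg z = up
  · have h1 : nonneg (z + boolSign up) = nonneg z := by
      subst h
      by_cases hz : 0 ≤ z <;> simp [nonneg, boolSign, hz] <;> omega
    have h2 : mag (z + boolSign up) = s c + 1 := by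
      rw [hs]
      subst h
      by_cases hz : 0 ≤ z <;> simp [nonneg, boolSign, hz, mag] <;> (try split) <;> omega
    rw [if_pos h, h1, h2]
    exact (Exec.inc c i s o (by omega)).bind (Exec.ret _ _)
  · rw [if_neg h]
    obtain rfl : up = !nonneg z := by cases up <;> cases hz : nonneg z <;> simp_all
    rcases hm : mag z with _ | k
    · have h1 : nonneg (z + boolSign (!nonneg z)) = !nonneg z := by
        unfold mag at hm
        by_cases hz : 0 ≤ z <;> simp [nonneg, boolSign, hz] at hm ⊢ <;> omega
      have h2 : mag (z + boolSign (!nonneg z)) = s c := by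
        rw [hs, hm]
        unfold mag at hm ⊢
        by_cases hz : 0 ≤ z <;> simp [nonneg, boolSign, hz] at hm ⊢ <;> (try split) <;> omega
      rw [h1, h2, Function.update_eq_self]
      exact (Exec.dec_zero c i s o (hs.trans hm)).bind (Exec.ret _ _)
    · have h1 : nonneg (z + boolSign (!nonneg z)) = nonneg z := by
        unfold mag at hm
        by_cases hz : 0 ≤ z <;> simp [nonneg, boolSign, hz] at hm ⊢ <;> omega
      have h2 : mag (z + boolSign (!nonneg z)) = k := by
        unfold mag at hm ⊢
        by_cases hz : 0 ≤ z <;> simp [nonneg, boolSign, hz] at hm ⊢ <;> (try split) <;> omega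
      rw [h1, h2]
      exact (Exec.dec_succ c i s o k (hs.trans hm)).bind (Exec.ret _ _)

/-- Test whether a counter is zero. -/
def isZero (c : Ctr) : Prog Bool :=
  (Frag.dec c).bind fun b =>
    if b then (Frag.inc c).bind fun _ => Frag.ret false else Frag.ret true

/-- The test decrements, so a nonzero counter is restored afterwards. -/
theorem exec_isZero (c : Ctr) (i : ℕ) (s : Ctr → ℕ) (o : List Letter) (hB : s c < 2 ^ B) :
    Exec w B (isZero c) ⟨i, s, o⟩ (decide (s c = 0)) ⟨i, s, o⟩ := by
  rcases h : s c with _ | k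
  · exact (Exec.dec_zero c i s o h).bind (Exec.ret _ _)
  · refine (Exec.dec_succ c i s o k h).bind ?_
    have := Exec.inc (w := w) (B := B) c i (Function.update s c k) o (by simp; omega)
    simp only [Function.update_self, Function.update_idem, ← h, Function.update_eq_self] at this
    exact this.bind (Exec.ret _ _)

/-- Move the value of a counter to another one and write `o` for each unit. -/
def drain (c d : Ctr) (o : List Letter) : Prog Unit :=
  Frag.iter (S := Unit) (fun _ => (Frag.dec c).bind fun b =>
    if b then (Frag.inc d).bind fun _ => (Frag.emit .stay o).bind fun _ => Frag.ret (.inl ())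
    else Frag.ret (.inr ())) ()

theorem exec_drain {c d : Ctr} (hcd : c ≠ d) (o' : List Letter) (i : ℕ) (s : Ctr → ℕ)
    (o : List Letter) (hB : s c + s d < 2 ^ B) :
    Exec w B (drain c d o') ⟨i, s, o⟩ ()
      ⟨i, Function.update (Function.update s c 0) d (s c + s d),
        o ++ (List.replicate (s c) o').flatten⟩ := by
  generalize hn : s c = n
  rw [hn] at hB
  induction n generalizing s o with
  | zero =>
    have hs : Function.update (Function.update s c 0) d (0 + s d) = s := by
      rw [zero_add, ← hn, Function.update_eq_self, Function.update_eq_self]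
    rw [hs, List.replicate_zero, List.flatten_nil, List.append_nil]
    exact Exec.iter_exit ((Exec.dec_zero c i s o hn).bind (Exec.ret _ _))
  | succ n ih =>
    refine Exec.iter_next ((Exec.dec_succ c i s o n hn).bind ((Exec.inc d i _ o ?_).bind
      ((Exec.emit _ _ _ _ _).bind (Exec.ret _ _)))) ?_
    · rw [Function.update_of_ne hcd.symm]
      omega
    · have := ih (Function.update (Function.update s c n) d (s d + 1)) (o ++ o')
        (by rw [Function.update_self]; omega) (by simp [Function.update_of_ne hcd])
      have hs : Function.update (Function.update
          (Function.update (Function.update s c n) d (s d + 1)) c 0) d (n + (s d + 1)) =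
          Function.update (Function.update s c 0) d (n + 1 + s d) := by
        rw [Function.update_comm hcd, Function.update_idem, Function.update_comm hcd.symm,
          Function.update_idem]
        congr 1
        omega
      rw [Function.update_self, hs] at this
      rw [Function.update_of_ne hcd.symm, List.replicate_succ, List.flatten_cons,
        ← List.append_assoc]
      exact this

/-- Set a counter to zero. -/
def clear (c : Ctr) : Prog Unit :=
  Frag.iter (S := Unit) (fun _ => (Frag.dec c).bind fun b =>
    Frag.ret (if b then .inl () else .inr ())) ()

theorem exec_clear (c : Ctr) (i : ℕ) (s : Ctr → ℕ) (o : List Letter) :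
    Exec w B (clear c) ⟨i, s, o⟩ () ⟨i, Function.update s c 0, o⟩ := by
  generalize hn : s c = n
  induction n generalizing s with
  | zero =>
    refine Exec.iter_exit ((Exec.dec_zero c i s o hn).bind ?_)
    rw [← hn, Function.update_eq_self]
    exact Exec.ret _ _
  | succ n ih =>
    refine Exec.iter_next ((Exec.dec_succ c i s o n hn).bind (Exec.ret _ _)) ?_
    have := ih (Function.update s c n) (by simp)
    rwa [Function.update_idem] at this

/-! ### Sweeps over the input -/

variable {S : Type} [Finite S]

/-- Run `body` on the letters of the input word from left to right. -/
def forward (body : S → Letter → Prog S) (s : S) : Prog S :=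
  Frag.iter (fun s => Frag.read.bind fun
    | .leftEnd => (Frag.emit .right []).bind fun _ => Frag.ret (.inl s)
    | .rightEnd => Frag.ret (.inr s)
    | .letter x => (body s x).bind fun s' => (Frag.emit .right []).bind fun _ =>
        Frag.ret (.inl s')) s

/-- Run `body` on the letters of the input word from right to left. -/
def backward (body : S → Letter → Prog S) (s : S) : Prog S :=
  Frag.iter (fun s => (Frag.emit .left []).bind fun _ => Frag.read.bind fun
    | .leftEnd => Frag.ret (.inr s)
    | .rightEnd => Frag.ret (.inl s)
    | .letter x => (body s x).bind fun s' => Frag.ret (.inl s')) s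

/-- The families `st` and `cnt` are the loop invariant, indexed by the number of letters to the left
of the head that have been read. -/
theorem exec_forward {body : S → Letter → Prog S} (st : ℕ → S) (cnt : ℕ → Ctr → ℕ)
    (o : List Letter)
    (h : ∀ i x, w[i]? = some x → Exec w B (body (st i) x) ⟨i + 1, cnt i, o⟩ (st (i + 1))
      ⟨i + 1, cnt (i + 1), o⟩) :
    Exec w B (forward body (st 0)) ⟨0, cnt 0, o⟩ (st w.length)
      ⟨w.length + 1, cnt w.length, o⟩ := by
  have key (i : ℕ) (hi : i ≤ w.length) :
      Exec w B (forward body (st i)) ⟨i + 1, cnt i, o⟩ (st w.length)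
        ⟨w.length + 1, cnt w.length, o⟩ := by
    induction hi using Nat.decreasingInduction with
    | self =>
      refine Exec.iter_exit ((Exec.read _ _ _).bind ?_)
      have : readInput w (w.length + 1) = .rightEnd := by simp [readInput]
      rw [this]
      exact Exec.ret _ _
    | of_succ i hi ih =>
      have : readInput w (i + 1) = .letter w[i] := by simp [readInput, hi]
      have hmove := Exec.emit (w := w) (B := B) .right [] (i + 1) (cnt (i + 1)) o
      rw [List.append_nil, show moveInput w.length .right (i + 1) = i + 1 + 1 by
        simp [moveInput]; omega] at hmove
      refine Exec.iter_next ((Exec.read _ _ _).bind ?_) ih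
      rw [this]
      exact (h i _ (by simp [hi])).bind (hmove.bind (Exec.ret _ _))
  have hmove := Exec.emit (w := w) (B := B) .right [] 0 (cnt 0) o
  rw [List.append_nil, show moveInput w.length .right 0 = 0 + 1 by simp [moveInput]] at hmove
  exact Exec.iter_next ((Exec.read _ _ _).bind (hmove.bind (Exec.ret _ _))) (key 0 (Nat.zero_le _))

theorem exec_backward {body : S → Letter → Prog S} (st : ℕ → S) (cnt : ℕ → Ctr → ℕ)
    (o : List Letter)
    (h : ∀ i x, w[i]? = some x → Exec w B (body (st (i + 1)) x) ⟨i + 1, cnt (i + 1), o⟩ (st i)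
      ⟨i + 1, cnt i, o⟩) :
    Exec w B (backward body (st w.length)) ⟨w.length + 1, cnt w.length, o⟩ (st 0)
      ⟨0, cnt 0, o⟩ := by
  have key (i : ℕ) (hi : i ≤ w.length) :
      Exec w B (backward body (st i)) ⟨i + 1, cnt i, o⟩ (st 0) ⟨0, cnt 0, o⟩ := by
    induction i with
    | zero =>
      have hmove := Exec.emit (w := w) (B := B) .left [] 1 (cnt 0) o
      rw [List.append_nil, show moveInput w.length .left 1 = 0 from rfl] at hmove
      exact Exec.iter_exit (hmove.bind ((Exec.read _ _ _).bind (Exec.ret _ _)))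
    | succ i ih =>
      have : readInput w (i + 1) = .letter w[i] := by
        simp [readInput, Nat.lt_of_succ_le hi]
      have hmove := Exec.emit (w := w) (B := B) .left [] (i + 2) (cnt (i + 1)) o
      rw [List.append_nil, show moveInput w.length .left (i + 2) = i + 1 from rfl] at hmove
      refine Exec.iter_next (hmove.bind ((Exec.read _ _ _).bind ?_)) (ih (by omega))
      rw [this]
      exact (h i _ (by simp [Nat.lt_of_succ_le hi])).bind (Exec.ret _ _)
  exact key _ le_rfl

end BaumslagSolitar

namespace BaumslagSolitar
open Logspace

variable {w : List Letter} {B : ℕ}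

/-! ### The program -/

/-- Update the height for a letter, or undo this. -/
def heightLetter (undo : Bool) (s : Bool) : Letter → Prog Bool
  | (.t, b) => step .height (b ^^ undo) s
  | (.a, _) => Frag.ret s

/-- Update the height and the carry for a letter. -/
def scanLetter (e : Bool) (s : Bool × Bool) : Letter → Prog (Bool × Bool)
  | (.t, b) => (step .height b s.1).bind fun s' => Frag.ret (s', s.2)
  | (.a, b) => (isZero .height).bind fun z =>
      if s.1 && z then (step .carry (b == e) s.2).bind fun s' => Frag.ret (s.1, s')
      else Frag.ret s

theorem exec_heightLetter (undo : Bool) (x : Letter) (z : ℤ) (k r a i : ℕ) (o : List Letter)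
    (hB : mag z + 1 < 2 ^ B) :
    Exec w B (heightLetter undo (nonneg z) x) ⟨i, cnts (mag z) k r a, o⟩
      (nonneg (z + boolSign (!undo) * letterExp x))
      ⟨i, cnts (mag (z + boolSign (!undo) * letterExp x)) k r a, o⟩ := by
  rcases x with ⟨_ | _, b⟩
  · simp only [letterExp, mul_zero, add_zero]
    exact Exec.ret _ _
  · have h : boolSign (!undo) * letterExp (.t, b) = boolSign (b ^^ undo) := by
      cases undo <;> cases b <;> rfl
    rw [h]
    have := exec_step (w := w) .height (b ^^ undo) z i (cnts (mag z) k r a) o rfl hB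
    rwa [update_height] at this

theorem exec_scanLetter (e : Bool) (x : Letter) (z k : ℤ) (r a i : ℕ) (o : List Letter)
    (hz : mag z + 1 < 2 ^ B) (hk : mag k + 1 < 2 ^ B) :
    Exec w B (scanLetter e (nonneg z, nonneg k) x) ⟨i, cnts (mag z) (mag k) r a, o⟩
      (nonneg (z + letterExp x), nonneg (k + boolSign e * letterHit x z))
      ⟨i, cnts (mag (z + letterExp x)) (mag (k + boolSign e * letterHit x z)) r a, o⟩ := by
  rcases x with ⟨_ | _, b⟩
  · refine (exec_isZero .height i _ o (by simp; omega)).bind ?_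
    -- The sign bit is needed because height `-1` also has magnitude `0`.
    have hz0 : (nonneg z && decide (cnts (mag z) (mag k) r a .height = 0)) = decide (z = 0) := by
      rw [cnts_height, ← Bool.decide_and]
      refine decide_eq_decide.2 ?_
      unfold mag
      by_cases h : 0 ≤ z <;> simp [h] <;> omega
    simp only [hz0, letterExp, add_zero, letterHit, decide_eq_true_eq]
    by_cases h : z = 0
    · rw [if_pos h, if_pos h]
      have hs : boolSign e * boolSign b = boolSign (b == e) := by cases e <;> cases b <;> rfl
      rw [hs]
      have := exec_step (w := w) .carry (b == e) k i (cnts (mag z) (mag k) r a) o rfl hk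
      rw [update_carry] at this
      exact this.bind (Exec.ret _ _)
    · rw [if_neg h, if_neg h, mul_zero, add_zero]
      exact Exec.ret _ _
  · simp only [letterHit, mul_zero, add_zero]
    have := exec_step (w := w) .height b z i (cnts (mag z) (mag k) r a) o rfl hz
    rw [update_height] at this
    exact this.bind (Exec.ret _ _)

theorem take_succ_of_getElem? {i : ℕ} {x : Letter} (h : w[i]? = some x) :
    w.take (i + 1) = w.take i ++ [x] := by
  rw [List.take_add_one, h]
  rfl

theorem exec_forward_scanLetter (e : Bool) (z k : ℤ) (r a : ℕ) (o : List Letter)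
    (hz : z.natAbs + w.length + 1 < 2 ^ B) (hk : k.natAbs + w.length + 1 < 2 ^ B) :
    Exec w B (forward (scanLetter e) (nonneg z, nonneg k)) ⟨0, cnts (mag z) (mag k) r a, o⟩
      (nonneg (z + tExp w), nonneg (k + boolSign e * hits w z))
      ⟨w.length + 1, cnts (mag (z + tExp w)) (mag (k + boolSign e * hits w z)) r a, o⟩ := by
  have := exec_forward (w := w) (B := B) (body := scanLetter e)
    (fun i => (nonneg (z + tExp (w.take i)), nonneg (k + boolSign e * hits (w.take i) z)))
    (fun i => cnts (mag (z + tExp (w.take i))) (mag (k + boolSign e * hits (w.take i) z)) r a) o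
    (fun i x hx => by
      have h1 := natAbs_tExp_le (w.take i)
      have h2 := natAbs_hits_le (w.take i) z
      have h3 := List.length_take_le' i w
      have h4 := mag_le (z + tExp (w.take i))
      have h5 := mag_le (k + boolSign e * hits (w.take i) z)
      have h6 : (boolSign e * hits (w.take i) z).natAbs = (hits (w.take i) z).natAbs := by
        rw [Int.natAbs_mul, natAbs_boolSign, one_mul]
      have := exec_scanLetter (w := w) (B := B) e x (z + tExp (w.take i))
        (k + boolSign e * hits (w.take i) z) r a (i + 1) o (by omega) (by omega)
      simp only [take_succ_of_getElem? hx, tExp_append, tExp_singleton, hits_append_singleton]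
      simpa only [mul_add, add_assoc] using this)
  simpa [tExp, hits] using this

/-- Undoing the letters on the way back recovers the initial height without a stored copy, and
brings the input head home. -/
theorem exec_backward_heightLetter (z : ℤ) (k r a : ℕ) (o : List Letter)
    (hz : z.natAbs + w.length + 1 < 2 ^ B) :
    Exec w B (backward (heightLetter true) (nonneg (z + tExp w)))
      ⟨w.length + 1, cnts (mag (z + tExp w)) k r a, o⟩ (nonneg z) ⟨0, cnts (mag z) k r a, o⟩ := by
  have := exec_backward (w := w) (B := B) (body := heightLetter true)
    (fun i => nonneg (z + tExp (w.take i)))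
    (fun i => cnts (mag (z + tExp (w.take i))) k r a) o
    (fun i x hx => by
      have h1 := natAbs_tExp_le (w.take (i + 1))
      have h3 := List.length_take_le' (i + 1) w
      have h4 := mag_le (z + tExp (w.take (i + 1)))
      have := exec_heightLetter (w := w) (B := B) true x (z + tExp (w.take (i + 1))) k r a
        (i + 1) o (by omega)
      have h5 : z + tExp (w.take (i + 1)) + boolSign (!true) * letterExp x =
          z + tExp (w.take i) := by
        rw [take_succ_of_getElem? hx, tExp_append, tExp_singleton]
        simp [boolSign]
        ring
      rwa [h5] at this)
  simpa [tExp] using this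

theorem exec_forward_heightLetter (k r a : ℕ) (o : List Letter) (hB : w.length + 1 < 2 ^ B) :
    Exec w B (forward (heightLetter false) true) ⟨0, cnts 0 k r a, o⟩
      (nonneg (tExp w)) ⟨w.length + 1, cnts (mag (tExp w)) k r a, o⟩ := by
  have := exec_forward (w := w) (B := B) (body := heightLetter false)
    (fun i => nonneg (tExp (w.take i))) (fun i => cnts (mag (tExp (w.take i))) k r a) o
    (fun i x hx => by
      have h1 := natAbs_tExp_le (w.take i)
      have h3 := List.length_take_le' i w
      have h4 := mag_le (tExp (w.take i))
      have := exec_heightLetter (w := w) (B := B) false x (tExp (w.take i)) k r a (i + 1) o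
        (by omega)
      simpa only [take_succ_of_getElem? hx, tExp_append, tExp_singleton, boolSign, Bool.not_false,
        if_true, one_mul] using this)
  rw [List.take_length] at this
  exact this

/-! ### Floor division of a signed counter by `p` -/

section Division

variable {p : ℕ} [NeZero p]

/-- Move the quotient by `p` of the carry to the auxiliary counter; the exit value is the
remainder. -/
def divide : Fin p → Prog (Fin p) :=
  Frag.iter fun r => (Frag.dec .carry).bind fun b =>
    if b then
      if h : r.1 + 1 < p then Frag.ret (.inl ⟨r.1 + 1, h⟩)
      else (Frag.inc .aux).bind fun _ => Frag.ret (.inl 0)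
    else Frag.ret (.inr r)

/-- With `r` kept in the finite control, the quantity `x * p + r + k` is invariant while `k` runs
down to zero. -/
theorem exec_divide (r : Fin p) (h k m x i : ℕ) (o : List Letter)
    (hB : x + k + 1 < 2 ^ B) :
    Exec w B (divide r) ⟨i, cnts h k m x, o⟩ (Fin.ofNat p (r + k))
      ⟨i, cnts h 0 m (x + (r + k) / p), o⟩ := by
  induction k generalizing r x with
  | zero =>
    have h1 : Fin.ofNat p (r + 0) = r := by ext; simp
    rw [h1, add_zero, Nat.div_eq_of_lt r.2, add_zero]
    exact Exec.iter_exit ((Exec.dec_zero Ctr.carry _ _ _ rfl).bind (Exec.ret _ _))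
  | succ k ih =>
    have hdec := Exec.dec_succ (w := w) (B := B) .carry i (cnts h (k + 1) m x) o k rfl
    rw [update_carry] at hdec
    by_cases hr : r.1 + 1 < p
    · refine Exec.iter_next (hdec.bind (σ' := ⟨i, cnts h k m x, o⟩) ?_)
        (σ' := ⟨i, cnts h k m x, o⟩) (s' := ⟨r.1 + 1, hr⟩) ?_
      · simp only [if_true, dif_pos hr]
        exact Exec.ret _ _
      · have := ih ⟨r.1 + 1, hr⟩ x (by omega)
        simp only [add_assoc, add_comm 1 k] at this
        exact this
    · have hinc := Exec.inc (w := w) (B := B) .aux i (cnts h k m x) o (by simp; omega)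
      rw [update_aux, cnts_aux] at hinc
      refine Exec.iter_next (hdec.bind (σ' := ⟨i, cnts h k m x, o⟩) ?_)
        (σ' := ⟨i, cnts h k m (x + 1), o⟩) (s' := 0) ?_
      · simp only [if_true, dif_neg hr]
        exact hinc.bind (Exec.ret _ _)
      · have := ih 0 (x + 1) (by omega)
        have hp : (r : ℕ) + (k + 1) = p + (0 + k) := by have := r.2; omega
        have hp0 : 0 < p := NeZero.pos p
        rw [hp, Nat.add_div_left _ hp0]
        have hf : Fin.ofNat p (p + (0 + k)) = Fin.ofNat p (0 + k) := by ext; simp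
        rw [hf]
        rw [Fin.val_zero] at this
        rw [show x + ((0 + k) / p).succ = x + 1 + (0 + k) / p by omega]
        exact this

/-- The digit of a number with the given sign bit, from the remainder of its stored number. -/
def signedDigit (s : Bool) (r : Fin p) : ℕ := if s then r else p - 1 - r

theorem signedDigit_eq (v : ℤ) : signedDigit (nonneg v) (Fin.ofNat p (mag v)) = (v % p).toNat := by
  have hp0 : 0 < p := NeZero.pos p
  unfold signedDigit mag
  rcases v with n | n
  · simp
    norm_cast
  · have h1 : ¬ (0 ≤ Int.negSucc n) := by omega
    have h2 : (-Int.negSucc n - 1).toNat = n := by omega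
    have h3 : n % p < p := Nat.mod_lt _ hp0
    rw [if_neg (by simp), if_neg h1, h2, Int.emod_negSucc]
    simp only [Fin.val_ofNat, Int.natAbs_natCast]
    rw [Int.subNatNat_of_le (by omega)]
    simp
    omega

theorem nonneg_ediv (v : ℤ) : nonneg (v / p) = nonneg v := by
  have hp0 : (0 : ℤ) < p := by exact_mod_cast NeZero.pos p
  simp [nonneg, Int.ediv_nonneg_iff_of_pos hp0]

/-- This motivates storing `-z - 1` for negative `z`: floor division of `-n - 1` is `-(n / p) - 1`,
so division of the stored number is right for both signs. -/
theorem mag_ediv (v : ℤ) : mag (v / p) = mag v / p := by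
  have hp0 : (0 : ℤ) < p := by exact_mod_cast NeZero.pos p
  have hs : 0 ≤ v / p ↔ 0 ≤ v := Int.ediv_nonneg_iff_of_pos hp0
  unfold mag
  rcases v with n | n
  · rw [if_pos (hs.2 (by simp)), if_pos (by simp)]
    simp
    norm_cast
  · have h1 : ¬ (0 ≤ Int.negSucc n) := by omega
    have h2 : (-Int.negSucc n - 1).toNat = n := by omega
    rw [if_neg (fun h => h1 (hs.1 h)), if_neg h1, h2, Int.negSucc_ediv _ hp0]
    simp
    norm_cast

end Division

/-! ### Output -/

theorem powWord_natCast (x : Gen) (n : ℕ) : powWord x n = List.replicate n (x, true) := by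
  simp [powWord]

theorem powWord_neg_natCast (x : Gen) (n : ℕ) : powWord x (-n) = List.replicate n (x, false) := by
  rcases n with _ | n
  · simp [powWord]
  · rw [powWord, decide_eq_false (by omega), Int.natAbs_neg, Int.natAbs_natCast]

theorem eq_mag_or (z : ℤ) : (z = mag z ∧ nonneg z = true) ∨
    (z = -((mag z + 1 : ℕ) : ℤ) ∧ nonneg z = false) := by
  unfold mag
  by_cases h : 0 ≤ z
  · exact .inl ⟨by simp [h], by simp [h]⟩
  · exact .inr ⟨by simp [h]; omega, by simp [h]⟩

/-- Draining a counter writes `mag z` letters; a negative `z` needs one more, which is written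
separately. -/
theorem powWord_neg (x : Gen) (z : ℤ) : powWord x (-z) =
    List.replicate (mag z) (x, !nonneg z) ++ if nonneg z then [] else [(x, true)] := by
  rcases eq_mag_or z with ⟨h, h'⟩ | ⟨h, h'⟩
  · rw [h', h, powWord_neg_natCast, ← h]
    simp
  · rw [h', h, neg_neg, powWord_natCast, ← h, List.replicate_succ']
    simp

theorem powWord_eq (x : Gen) (z : ℤ) : powWord x z =
    (if nonneg z then [] else [(x, false)]) ++ List.replicate (mag z) (x, nonneg z) := by
  rcases eq_mag_or z with ⟨h, h'⟩ | ⟨h, h'⟩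
  · rw [h', h, powWord_natCast, ← h]
    simp
  · rw [h', h, powWord_neg_natCast, ← h, List.replicate_succ]
    simp

theorem powWord_boolSign_mul (x : Gen) (e : Bool) (d : ℕ) :
    powWord x (boolSign e * d) = List.replicate d (x, e) := by
  cases e
  · simpa [boolSign] using powWord_neg_natCast x d
  · simpa [boolSign] using powWord_natCast x d

/-- Write the word `t ^ z` where `z` is the height. -/
def writeHeight (c d : Ctr) (s : Bool) : Prog Unit :=
  (Frag.emit .stay (if s then [] else [(.t, false)])).bind fun _ => drain c d [(.t, s)]

theorem flatten_replicate_singleton {α : Type*} (n : ℕ) (x : α) :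
    (List.replicate n [x]).flatten = List.replicate n x := by
  induction n with
  | zero => rfl
  | succ n ih => simp [List.replicate_succ, ih]

theorem exec_writeHeight {c d : Ctr} (hcd : c ≠ d) (z : ℤ) (i : ℕ) (s : Ctr → ℕ)
    (o : List Letter) (hs : s c = mag z) (hd : s d = 0) (hB : mag z < 2 ^ B) :
    Exec w B (writeHeight c d (nonneg z)) ⟨i, s, o⟩ ()
      ⟨i, Function.update (Function.update s c 0) d (mag z), o ++ powWord .t z⟩ := by
  have := exec_drain (w := w) (B := B) hcd [(.t, nonneg z)] i s
    (o ++ if nonneg z then [] else [(.t, false)]) (by omega)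
  rw [hs, hd, add_zero, flatten_replicate_singleton, List.append_assoc, ← powWord_eq] at this
  exact (Exec.emit _ _ _ _ _).bind this

/-- Write the word `(a ^ ± d) ^ (t ^ z)` where `z` is the height. -/
def writeConj (e s : Bool) (d : ℕ) : Prog Unit :=
  (drain .height .aux [(.t, !s)]).bind fun _ =>
    (Frag.emit .stay ((if s then [] else [(.t, true)]) ++ List.replicate d (.a, e))).bind fun _ =>
      writeHeight .aux .height s

/-- Writing `t ^ (-z)` moves the height into the auxiliary counter, and writing `t ^ z` moves it
back. -/
theorem exec_writeConj (e : Bool) (d : ℕ) (z : ℤ) (i k r : ℕ) (o : List Letter)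
    (hB : mag z < 2 ^ B) :
    Exec w B (writeConj e (nonneg z) d) ⟨i, cnts (mag z) k r 0, o⟩ ()
      ⟨i, cnts (mag z) k r 0, o ++ conjWord (boolSign e * d) z⟩ := by
  have h1 := exec_drain (w := w) (B := B) (c := .height) (d := .aux) (by decide)
    [(.t, !nonneg z)] i (cnts (mag z) k r 0) o (by simpa using hB)
  have h3 := exec_writeHeight (w := w) (B := B) (c := .aux) (d := .height) (by decide) z i
    (cnts 0 k r (mag z)) (o ++ powWord .t (-z) ++ List.replicate d (.a, e)) rfl rfl hB
  simp only [update_height, update_aux, cnts_height, cnts_aux, add_zero,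
    flatten_replicate_singleton] at h1 h3
  rw [powWord_neg] at h3
  simp only [conjWord, powWord_boolSign_mul, powWord_neg]
  simp only [List.append_assoc] at h3 ⊢
  refine h1.bind ((Exec.emit _ _ _ _ _).bind ?_)
  simp only [List.append_assoc]
  exact h3

end BaumslagSolitar

namespace BaumslagSolitar
open Logspace

/-! ### The complete program and its space bound -/

variable {w : List Letter} {B : ℕ}

/-- Set the height to `n` and the number of rounds to `3 * n + 1`. -/
def countLength : Prog Unit :=
  (forward (fun _ _ => (Frag.inc .height).bind fun _ => (Frag.inc .rounds).bind fun _ =>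
    (Frag.inc .rounds).bind fun _ => Frag.inc .rounds) ()).bind fun _ =>
  (backward (fun s _ => Frag.ret s) ()).bind fun _ => Frag.inc .rounds

theorem exec_countLength (k x : ℕ) (o : List Letter) (hB : 3 * w.length + 1 < 2 ^ B) :
    Exec w B countLength ⟨0, cnts 0 k 0 x, o⟩ ()
      ⟨0, cnts w.length k (3 * w.length + 1) x, o⟩ := by
  have h1 := exec_forward (w := w) (B := B) (body := fun _ _ => (Frag.inc .height).bind fun _ =>
    (Frag.inc .rounds).bind fun _ => (Frag.inc .rounds).bind fun _ => Frag.inc .rounds)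
    (fun _ => ()) (fun i => cnts i k (3 * i) x) o (fun i y hy => by
      have hi : i < w.length := (List.getElem?_eq_some_iff.1 hy).1
      have e1 := Exec.inc (w := w) (B := B) .height (i + 1) (cnts i k (3 * i) x) o
        (by simp; omega)
      have e2 (j : ℕ) (hj : j < 3) := Exec.inc (w := w) (B := B) .rounds (i + 1)
        (cnts (i + 1) k (3 * i + j) x) o (by simp; omega)
      simp only [update_height, update_rounds, cnts_height, cnts_rounds] at e1 e2
      exact e1.bind ((e2 0 (by omega)).bind ((e2 1 (by omega)).bind (e2 2 (by omega)))))
  have h2 := exec_backward (w := w) (B := B) (body := fun s _ => Frag.ret s)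
    (fun _ => ()) (fun i => cnts w.length k (3 * w.length) x) o (fun i y hy => Exec.ret _ _)
  have h3 := Exec.inc (w := w) (B := B) .rounds 0 (cnts w.length k (3 * w.length) x) o
    (by simpa using hB)
  simp only [update_rounds, cnts_rounds] at h3
  exact h1.bind (h2.bind h3)

section

variable {p : ℕ} [NeZero p]

/-- Divide the carry by `p`. -/
def divideCarry : Prog (Fin p) :=
  (divide 0).bind fun r => (drain .aux .carry []).bind fun _ => Frag.ret r

theorem exec_divideCarry (v : ℤ) (h m i : ℕ) (o : List Letter) (hB : mag v + 1 < 2 ^ B) :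
    Exec w B (divideCarry (p := p)) ⟨i, cnts h (mag v) m 0, o⟩ (Fin.ofNat p (mag v))
      ⟨i, cnts h (mag (v / p)) m 0, o⟩ := by
  have h1 := exec_divide (w := w) (B := B) (p := p) 0 h (mag v) m 0 i o (by omega)
  simp only [Fin.val_zero, zero_add] at h1
  have h2 := exec_drain (w := w) (B := B) (c := .aux) (d := .carry) (by decide) [] i
    (cnts h 0 m (mag v / p)) o (by
      have := Nat.div_le_self (mag v) p
      simp
      omega)
  simp only [update_aux, update_carry, cnts_aux, cnts_carry, add_zero, List.flatten_replicate_nil,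
    List.append_nil] at h2
  rw [mag_ediv]
  exact h1.bind (h2.bind (Exec.ret _ _))

variable (p) in
/-- One round: compute one digit, write it if `out`, and lower the height. -/
def round (out e : Bool) (s : Bool × Bool) : Prog (Bool × Bool) :=
  (forward (scanLetter e) s).bind fun s₁ =>
  (backward (heightLetter true) s₁.1).bind fun h =>
  (divideCarry (p := p)).bind fun r =>
  (if out ∧ signedDigit s₁.2 r ≠ 0 then writeConj e h (signedDigit s₁.2 r)
    else Frag.ret ()).bind fun _ =>
  (step .height false h).bind fun h' => Frag.ret (h', s₁.2)

/-- The output of a round. -/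
def roundOutput (out e : Bool) (d : ℕ) (z : ℤ) : List Letter :=
  if out ∧ d ≠ 0 then conjWord (boolSign e * d) z else []

theorem exec_round (out e : Bool) (z k : ℤ) (r : ℕ) (o : List Letter)
    (hz : z.natAbs + w.length + 1 < 2 ^ B) (hk : k.natAbs + w.length + 1 < 2 ^ B) :
    Exec w B (round p out e (nonneg z, nonneg k)) ⟨0, cnts (mag z) (mag k) r 0, o⟩
      (nonneg (z - 1), nonneg ((k + boolSign e * hits w z) / p))
      ⟨0, cnts (mag (z - 1)) (mag ((k + boolSign e * hits w z) / p)) r 0,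
        o ++ roundOutput out e ((k + boolSign e * hits w z) % p).toNat z⟩ := by
  have hv : mag (k + boolSign e * hits w z) + 1 < 2 ^ B := by
    have h2 := natAbs_hits_le w z
    have h5 := mag_le (k + boolSign e * hits w z)
    have h6 : (boolSign e * hits w z).natAbs = (hits w z).natAbs := by
      rw [Int.natAbs_mul, natAbs_boolSign, one_mul]
    omega
  have hm := mag_le z
  have h1 := exec_forward_scanLetter (w := w) (B := B) e z k r 0 o hz hk
  have h2 := exec_backward_heightLetter (w := w) (B := B) z (mag (k + boolSign e * hits w z)) r 0 o
    hz
  have h3 := exec_divideCarry (w := w) (B := B) (p := p) (k + boolSign e * hits w z) (mag z) r 0 o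
    hv
  refine h1.bind (h2.bind (h3.bind ?_))
  simp only [signedDigit_eq, nonneg_ediv]
  have h4 : Exec w B (if out ∧ ((k + boolSign e * hits w z) % p).toNat ≠ 0 then
      writeConj e (nonneg z) ((k + boolSign e * hits w z) % p).toNat else Frag.ret ())
      ⟨0, cnts (mag z) (mag ((k + boolSign e * hits w z) / p)) r 0, o⟩ ()
      ⟨0, cnts (mag z) (mag ((k + boolSign e * hits w z) / p)) r 0,
        o ++ roundOutput out e ((k + boolSign e * hits w z) % p).toNat z⟩ := by
    unfold roundOutput
    split
    · exact exec_writeConj e _ z 0 _ r o (by omega)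
    · rw [List.append_nil]
      exact Exec.ret _ _
  have h5 := exec_step (w := w) (B := B) .height false z 0
    (cnts (mag z) (mag ((k + boolSign e * hits w z) / p)) r 0)
    (o ++ roundOutput out e ((k + boolSign e * hits w z) % p).toNat z) rfl (by omega)
  rw [update_height] at h5
  exact h4.bind (h5.bind (Exec.ret _ _))

variable (p) in
/-- All rounds. -/
def rounds (out e : Bool) : Bool × Bool → Prog (Bool × Bool) :=
  Frag.iter fun s => (Frag.dec .rounds).bind fun b =>
    if b then (round p out e s).bind fun s' => Frag.ret (.inl s') else Frag.ret (.inr s)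

/-- After `j` rounds the height is `n - j` and the carry is the `j`-th carry. As `j ≤ 3 * n + 1`,
heights stay within the `B` digits even during a scan. -/
theorem exec_rounds (hp : 2 ≤ p) (out e : Bool) (r j : ℕ) (o : List Letter)
    (hj : j + r = 3 * w.length + 1) (hB : 3 * w.length + 3 < 2 ^ B) :
    Exec w B (rounds p out e (nonneg ((w.length : ℤ) - j), nonneg (carrySeq p (coeffSeq w e) j)))
      ⟨0, cnts (mag ((w.length : ℤ) - j)) (mag (carrySeq p (coeffSeq w e) j)) r 0, o⟩
      (nonneg ((w.length : ℤ) - ↑(j + r)), nonneg (carrySeq p (coeffSeq w e) (j + r)))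
      ⟨0, cnts (mag ((w.length : ℤ) - ↑(j + r))) (mag (carrySeq p (coeffSeq w e) (j + r))) 0 0,
        o ++ (List.range' j r).flatMap fun j =>
          roundOutput out e (digitSeq p (coeffSeq w e) j) ((w.length : ℤ) - j)⟩ := by
  induction r generalizing j o with
  | zero =>
    rw [add_zero, List.range'_zero, List.flatMap_nil, List.append_nil]
    exact Exec.iter_exit ((Exec.dec_zero Ctr.rounds _ _ _ rfl).bind (Exec.ret _ _))
  | succ r ih =>
    have hdec := Exec.dec_succ (w := w) (B := B) .rounds 0
      (cnts (mag ((w.length : ℤ) - j)) (mag (carrySeq p (coeffSeq w e) j)) (r + 1) 0) o r rfl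
    rw [update_rounds] at hdec
    have hc := natAbs_carrySeq_le hp (natAbs_coeffSeq_le w e) j
    have hround := exec_round (w := w) (B := B) (p := p) out e ((w.length : ℤ) - j)
      (carrySeq p (coeffSeq w e) j) r o (by omega) (by omega)
    refine Exec.iter_next (hdec.bind (hround.bind (Exec.ret _ _))) ?_
    have := ih (j + 1) (o ++ roundOutput out e (digitSeq p (coeffSeq w e) j) ((w.length : ℤ) - j))
      (by omega)
    rw [show j + 1 + r = j + (r + 1) by omega, show (w.length : ℤ) - ((j + 1 : ℕ) : ℤ) =
      (w.length : ℤ) - j - 1 by push_cast; ring] at this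
    rw [List.range'_succ, List.flatMap_cons, ← List.append_assoc]
    exact this

variable (p) in
/-- Compute all digits; the exit value is the sign bit of the final carry. -/
def pass (out e : Bool) : Prog Bool :=
  countLength.bind fun _ => (rounds p out e (true, true)).bind fun s =>
    (clear .height).bind fun _ => Frag.ret s.2

theorem exec_pass (hp : 2 ≤ p) (out e : Bool) (o : List Letter) (hB : 3 * w.length + 3 < 2 ^ B) :
    Exec w B (pass p out e) ⟨0, cnts 0 0 0 0, o⟩
      (nonneg (carrySeq p (coeffSeq w e) (3 * w.length + 1)))
      ⟨0, cnts 0 0 0 0, o ++ (List.range (3 * w.length + 1)).flatMap fun j =>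
        roundOutput out e (digitSeq p (coeffSeq w e) j) ((w.length : ℤ) - j)⟩ := by
  have h1 := exec_countLength (w := w) (B := B) 0 0 o (by omega)
  have h2 := exec_rounds (w := w) (B := B) hp out e (3 * w.length + 1) 0 o (by omega) hB
  -- The final carry `0` or `-1` is stored as `0`, so its counter is already clear and its sign bit
  -- carries all the information.
  have h3 : mag (carrySeq p (coeffSeq w e) (0 + (3 * w.length + 1))) = 0 := by
    rw [zero_add]
    rcases carrySeq_coeffSeq_final w hp e with h | h <;> rw [h] <;> rfl
  have h4 : nonneg ((w.length : ℤ) - (0 : ℕ)) = true := by simp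
  have h5 : mag ((w.length : ℤ) - (0 : ℕ)) = w.length := by simp [mag]
  rw [h3, h4, h5, zero_add, ← List.range_eq_range'] at h2
  have h6 := exec_clear (w := w) (B := B) .height 0
    (cnts (mag ((w.length : ℤ) - ↑(3 * w.length + 1))) 0 0 0)
    (o ++ (List.range (3 * w.length + 1)).flatMap fun j =>
        roundOutput out e (digitSeq p (coeffSeq w e) j) ((w.length : ℤ) - j))
  rw [update_height] at h6
  exact h1.bind (h2.bind (h6.bind (Exec.ret _ _)))

variable (p) in
/-- The program that computes the normal form: the first pass finds the sign, the second one writes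
the digits, and then the power of `t` is written. -/
def normalProg : Prog Unit :=
  (pass p false true).bind fun e => (pass p true e).bind fun _ =>
    (forward (heightLetter false) true).bind fun s => writeHeight .height .aux s

theorem exec_normalProg (hp : 2 ≤ p) (hB : 3 * w.length + 3 < 2 ^ B) :
    ∃ i s, Exec w B (normalProg p) ⟨0, fun _ => 0, []⟩ () ⟨i, s, normalWord p w⟩ := by
  have h0 : (fun _ => 0 : Ctr → ℕ) = cnts 0 0 0 0 := by funext c; cases c <;> rfl
  have h1 := exec_pass (w := w) (B := B) hp false true [] hB
  have hout : ((List.range (3 * w.length + 1)).flatMap fun j =>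
      roundOutput false true (digitSeq p (coeffSeq w true) j) ((w.length : ℤ) - j)) = [] := by
    simp [roundOutput]
  rw [hout, List.append_nil] at h1
  -- By definition, `entrySign` is the exit value of the first pass.
  have h2 := exec_pass (w := w) (B := B) hp true (entrySign p w) [] hB
  have hout2 : ((List.range (3 * w.length + 1)).flatMap fun j =>
      roundOutput true (entrySign p w) (digitSeq p (coeffSeq w (entrySign p w)) j)
        ((w.length : ℤ) - j)) =
      (digitList p w).flatMap fun d => conjWord (boolSign (entrySign p w) * d.1) d.2 := by
    rw [digitList, flatMap_filter_eq, List.flatMap_map]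
    simp [roundOutput]
  rw [hout2, List.nil_append] at h2
  have h3 := exec_forward_heightLetter (w := w) (B := B) 0 0 0 ((digitList p w).flatMap fun d =>
    conjWord (boolSign (entrySign p w) * d.1) d.2) (by omega)
  have h4 := exec_writeHeight (w := w) (B := B) (c := .height) (d := .aux) (by decide) (tExp w)
    (w.length + 1) (cnts (mag (tExp w)) 0 0 0) ((digitList p w).flatMap fun d =>
    conjWord (boolSign (entrySign p w) * d.1) d.2) rfl rfl (by
      have := mag_le (tExp w)
      have := natAbs_tExp_le w
      omega)
  rw [h0]
  exact ⟨_, _, h1.bind (h2.bind (h3.bind h4))⟩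

theorem logspaceComputable_normalWord (hp : 2 ≤ p) : LogspaceComputable (normalWord p) := by
  refine ⟨(Frag.mark.bind fun _ => normalProg p).toTransducer (false, fun _ => none), 5,
    fun w => ?_⟩
  -- With `n < 2 * 2 ^ log n`, the left side is at most `9 * 2 ^ log n`. The space `B + 1 = log n +
  -- 5` is at most `5 * (log n + 1)`.
  have hB : 3 * w.length + 3 < 2 ^ (Nat.log 2 w.length + 4) := by
    have := Nat.lt_pow_succ_log_self (b := 2) (by norm_num) w.length
    rw [pow_succ] at this
    have := Nat.one_le_two_pow (n := Nat.log 2 w.length)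
    rw [pow_add]
    omega
  obtain ⟨i, s, h⟩ := exec_normalProg (w := w) hp hB
  obtain ⟨h1, h2⟩ := h.haltsWith
  exact ⟨h1, fun C hC => (h2 C hC).trans_le (by omega)⟩

end

end BaumslagSolitar

theorem mainTheorem5 (p : ℕ) (hp : 2 ≤ p) :
    -- the words form a normal form, which some logspace computable function computes
    (Logspace.IsNormalForm (BaumslagSolitar.letterVal p) (BaumslagSolitar.normalForm p) ∧
      ∃ f : List BaumslagSolitar.Letter → List BaumslagSolitar.Letter,
        Logspace.IsLogspaceNormalFormFunction (BaumslagSolitar.letterVal p)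
          (BaumslagSolitar.normalForm p) f) ∧
    -- every element has exactly one expression of exactly one of the three kinds
    (∀ g : BaumslagSolitar.BS p, ∃! N : BaumslagSolitar.NF p,
      Logspace.wordVal (BaumslagSolitar.letterVal p) N.word = g) ∧
    -- the expression records the `p`-ary expansion of the matrix entry in `ℤ[1/p]`
    (∃ ρ : BaumslagSolitar.BS p →* Matrix (Fin 2) (Fin 2) ℚ,
      ρ (BaumslagSolitar.gen p .t) = !![(p : ℚ), 0; 0, 1] ∧
      ρ (BaumslagSolitar.gen p .a) = !![1, 1; 0, 1] ∧
      Function.Injective ρ ∧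
      Set.range ρ = {A | ∃ i : ℤ, ∃ m ∈ Algebra.adjoin ℤ {(p : ℚ)⁻¹},
        A = !![(p : ℚ) ^ i, m; 0, 1]} ∧
      ∀ N : BaumslagSolitar.NF p,
        ρ (Logspace.wordVal (BaumslagSolitar.letterVal p) N.word) =
          !![(p : ℚ) ^ N.texp, N.entry; 0, 1]) := by
  have : NeZero p := ⟨by omega⟩
  have hword := BaumslagSolitar.rho_word p
  have hinj := BaumslagSolitar.wordVal_word_injective (p := p) hp
  -- Existence comes from the algorithm, applied to any word that represents `g`.
  have hex (g : BaumslagSolitar.BS p) : ∃ N : BaumslagSolitar.NF p,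
      Logspace.wordVal (BaumslagSolitar.letterVal p) N.word = g := by
    obtain ⟨w, rfl⟩ := BaumslagSolitar.wordVal_surjective g
    obtain ⟨N, hN⟩ := BaumslagSolitar.normalWord_mem w hp
    exact ⟨N, hN ▸ BaumslagSolitar.wordVal_normalWord w hp⟩
  refine ⟨⟨⟨fun _ _ => Set.mem_univ _, ?_, fun g _ => ?_⟩, BaumslagSolitar.normalWord p,
    BaumslagSolitar.logspaceComputable_normalWord hp, fun w =>
      ⟨BaumslagSolitar.normalWord_mem w hp, BaumslagSolitar.wordVal_normalWord w hp⟩⟩,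
    fun g => ?_, BaumslagSolitar.rho p, BaumslagSolitar.rho_t p, BaumslagSolitar.rho_a p,
    BaumslagSolitar.rho_injective p hp, BaumslagSolitar.range_rho p, hword⟩
  · rintro _ ⟨N, rfl⟩ _ ⟨N', rfl⟩ h
    rw [hinj h]
  · obtain ⟨N, hN⟩ := hex g
    exact ⟨_, ⟨N, rfl⟩, hN⟩
  · obtain ⟨N, hN⟩ := hex g
    exact ⟨N, hN, fun N' hN' => hinj (hN'.trans hN.symm)⟩
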